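/- Work over $\mathbb{C}$. Let $H=\mathbb{C}(\!(t)\!)$ with the $t$-adic topology, and let $H'\subset H$ be the space of Laurent series with zero constant term, with $H'_+=t\,\mathbb{C}[\![t]\!]$ and $H_-=t^{-1}\mathbb{C}[t^{-1}]$, so that $H'=H'_+\oplus H_-$ with projections $\pi_+,\pi_-$. Equip $H'$ with the symplectic form $\langle f,g\rangle=-\mathrm{Res}_{t=0}\, f\,dg$. Let $\mathfrak{sp}(H')$ be the Lie algebra of continuous linear endomorphisms $X$ of $H'$ with $\langle Xa,b\rangle+\langle a,Xb\rangle=0$ for all $a,b\in H'$, with the topology in which the sets $\{X : X(t^{-N}\mathbb{C}[\![t]\!]\cap H')\subseteq t^{N}\mathbb{C}[\![t]\!]\}$, $N\ge 0$, form a basis of neighbourhoods of $0$. Let $\mathfrak{sp}(H')\ltimes H'$ be the semidirect product, with bracket $[X+f,Y+g]=XY-YX+X(g)-Y(f)$ and the product topology. A continuous central extension of a topological Lie algebra $\mathfrak{g}$ is a central extension of complex Lie algebras $0\to\mathfrak{gl}_1\to\widehat{\mathfrak{g}}\to\mathfrak{g}\to 0$, with $\mathfrak{gl}_1=\mathbb{C}$,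 in which $\widehat{\mathfrak{g}}$ is a Hausdorff topological Lie algebra (addition, multiplication by each scalar and the bracket are continuous), the projection $\widehat{\mathfrak{g}}\to\mathfrak{g}$ is continuous and has a continuous linear section. It splits over a Lie subalgebra $\mathfrak{k}\subseteq\mathfrak{g}$ if there is a continuous Lie algebra homomorphism $\mathfrak{k}\to\widehat{\mathfrak{g}}$ lifting the inclusion $\mathfrak{k}\subseteq\mathfrak{g}$. Put $\psi(X,Y)=\mathrm{Tr}(\pi_+X\pi_-Y\pi_+-\pi_+Y\pi_-X\pi_+)$. Let $\mathfrak{mp}(H')$ be the central extension of $\mathfrak{sp}(H')$ by $\mathfrak{gl}_1$ defined by the two-cocycle $-\tfrac12\psi(X,Y)$, and let $\widetilde{\mathscr{U}}_2(H)$ be the central extension of $\mathfrak{sp}(H')\ltimes H'$ by $\mathfrak{gl}_1$ defined by the two-cocycle $c(X+f,Y+g)=-\tfrac12\psi(X,Y)+\langle f,g\rangle$; both carry the product topology, with $\mathfrak{gl}_1$ discrete. Proposition. Let $Z$ be a Lagrangian subspace of $H'$ (that is, $Z^\perp=Z$) with $Z\cap H'_+=0$, let $F\subseteq Z$ be a linear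 subspace, and let $\mathfrak{sp}_F(H')=\{X\in\mathfrak{sp}(H') : X(F^\perp)\subseteq F\}$. (1) Every continuous central extension of $\mathfrak{sp}(H')$ by $\mathfrak{gl}_1$ splits over $\mathfrak{sp}_F(H')$. In particular, $\mathfrak{mp}(H')$ is a continuous central extension of $\mathfrak{sp}(H')$ and splits over $\mathfrak{sp}_F(H')$. (2) Every continuous central extension of $\mathfrak{sp}(H')\ltimes H'$ by $\mathfrak{gl}_1$ splits over $\mathfrak{sp}_F(H')\ltimes F$. In particular, $\widetilde{\mathscr{U}}_2(H)$ is a continuous central extension of $\mathfrak{sp}(H')\ltimes H'$ and splits over $\mathfrak{sp}_F(H')\ltimes F$. -/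

import Mathlib

open Filter Topology

namespace Metaplectic

noncomputable section

/-! ### The symplectic space of Laurent series without constant term

Laurent series `LaurentSeries ℂ` carry the `t`-adic topology (Mathlib's valuation topology). -/

/-- The subspace of formal complex Laurent series with zero constant term. -/
def HPrimeSubmodule : Submodule ℂ (LaurentSeries ℂ) where
  carrier := {f | f.coeff 0 = 0}
  add_mem' {f g} hf hg := by
    change f.coeff 0 = 0 at hf
    change g.coeff 0 = 0 at hg
    change (f + g).coeff 0 = 0
    simp [hf, hg]
  zero_mem' := HahnSeries.coeff_zero
  smul_mem' c f hf := by
    change f.coeff 0 = 0 at hf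
    change (c • f).coeff 0 = 0
    simp [hf]

/-- `H'`: formal complex Laurent series with zero constant term, with the subspace topology of the
`t`-adic topology. -/
def HPrime : Type := HPrimeSubmodule

instance : AddCommGroup HPrime := inferInstanceAs (AddCommGroup HPrimeSubmodule)
instance : Module ℂ HPrime := inferInstanceAs (Module ℂ HPrimeSubmodule)
instance : TopologicalSpace HPrime := inferInstanceAs (TopologicalSpace HPrimeSubmodule)
instance : IsTopologicalAddGroup HPrime := inferInstanceAs (IsTopologicalAddGroup HPrimeSubmodule)

/-- The Laurent series underlying an element of `H'`. -/
def HPrime.val (f : HPrime) : LaurentSeries ℂ := Subtype.val f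

instance : CoeOut HPrime (LaurentSeries ℂ) := ⟨HPrime.val⟩

@[simp] theorem HPrime.val_add (f g : HPrime) : (f + g).val = f.val + g.val := rfl
@[simp] theorem HPrime.val_sub (f g : HPrime) : (f - g).val = f.val - g.val := rfl
@[simp] theorem HPrime.val_zero : (0 : HPrime).val = 0 := rfl
@[simp] theorem HPrime.val_smul (c : ℂ) (f : HPrime) : (c • f).val = c • f.val := rfl

theorem HPrime.ext {f g : HPrime} (h : ∀ n, f.val.coeff n = g.val.coeff n) : f = g :=
  Subtype.ext (HahnSeries.ext (funext h))

/-- `t ^ N ℂ⟦t⟧ ∩ H'`. -/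
def lattice (N : ℤ) : Submodule ℂ HPrime where
  carrier := {f | ∀ n < N, (f : LaurentSeries ℂ).coeff n = 0}
  add_mem' {f g} hf hg n hn := by simp [hf n hn, hg n hn]
  zero_mem' n _ := by simp
  smul_mem' c f hf n hn := by simp [hf n hn]

/-- `H'_+ = t ℂ⟦t⟧`. -/
def HPlus : Submodule ℂ HPrime := lattice 1

/-- `b_n = t ^ n` for `n ≠ 0`, and `b_0 = 0` in `H'`. -/
def b (n : ℤ) : HPrime :=
  ⟨if n = 0 then 0 else HahnSeries.single n 1, by
    change HahnSeries.coeff _ 0 = 0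
    split_ifs with h
    · simp
    · exact HahnSeries.coeff_single_of_ne (Ne.symm h)⟩

/-- The projection `π_-` onto `H_- = t⁻¹ ℂ[t⁻¹]` along `H'_+`. -/
def piMinus : Module.End ℂ HPrime where
  toFun f := ⟨HahnSeries.truncLT 0 (f : LaurentSeries ℂ), by
    change HahnSeries.coeff _ 0 = 0
    simp⟩
  map_add' f g := Subtype.ext (HahnSeries.truncLT_add _ _ _)
  map_smul' c f := Subtype.ext (HahnSeries.truncLT_smul _ _ _)

/-- The projection `π_+` onto `H'_+` along `H_-`. -/
def piPlus : Module.End ℂ HPrime := 1 - piMinus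

/-- The symplectic form `⟨f, g⟩ = - Res_{t=0} f dg` on `H'`. -/
def symp : LinearMap.BilinForm ℂ HPrime :=
  LinearMap.mk₂ ℂ
    (fun f g => -((f : LaurentSeries ℂ) * LaurentSeries.derivative ℂ (g : LaurentSeries ℂ)).coeff
      (-1))
    (by intro f f' g; simp [add_mul]; ring)
    (by
      intro c f g
      rw [HPrime.val_smul, ← HahnSeries.C_mul_eq_smul, mul_assoc, HahnSeries.C_mul_eq_smul,
        HahnSeries.coeff_smul, smul_neg])
    (by intro f g g'; simp [mul_add]; ring)
    (by
      intro c f g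
      rw [HPrime.val_smul, map_smul, ← HahnSeries.C_mul_eq_smul, mul_left_comm,
        HahnSeries.C_mul_eq_smul, HahnSeries.coeff_smul, smul_neg])

theorem lattice_anti {m n : ℤ} (h : m ≤ n) : lattice n ≤ lattice m :=
  fun _ hf k hk => hf k (lt_of_lt_of_le hk h)

theorem exists_mem_lattice (f : HPrime) : ∃ N : ℤ, f ∈ lattice N :=
  ⟨(f : LaurentSeries ℂ).order, fun _ hn => HahnSeries.coeff_eq_zero_of_lt_order hn⟩

theorem coeff_zero_eq (f : HPrime) : (f : LaurentSeries ℂ).coeff 0 = 0 := f.2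

theorem coeff_b (k n : ℤ) :
    (b k : LaurentSeries ℂ).coeff n = if n = k ∧ k ≠ 0 then 1 else 0 := by
  change HahnSeries.coeff (if k = 0 then 0 else HahnSeries.single k 1) n = _
  by_cases hk : k = 0
  · simp [hk]
  · by_cases hn : n = k
    · subst hn; simp [hk]
    · rw [if_neg hk, HahnSeries.coeff_single_of_ne hn, if_neg (fun h => hn h.1)]

theorem b_mem (k : ℤ) : b k ∈ lattice k := fun n hn => by
  rw [coeff_b, if_neg]; rintro ⟨h, -⟩; omega

theorem nhds_zero_basis :
    (𝓝 (0 : HPrime)).HasBasis (fun _ : ℤ => True) (fun N => (lattice N : Set HPrime)) := by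
  have hn : 𝓝 (0 : HPrime) = comap HPrime.val (𝓝 ((0 : HPrime) : LaurentSeries ℂ)) :=
    nhds_induced _ _
  rw [hn]
  have h0 : (𝓝 ((0 : HPrime) : LaurentSeries ℂ)).HasBasis (fun _ : ℤ => True)
      (fun N => {f : LaurentSeries ℂ | ∀ n < N, f.coeff n = 0}) := by
    rw [HPrime.val_zero]
    refine (Valued.hasBasis_nhds_zero (LaurentSeries ℂ) _).to_hasBasis ?_ ?_
    · rintro γ -
      have hne : MonoidWithZeroHom.ValueGroup₀.embedding γ.1 ≠ 0 := by simp
      refine ⟨-(WithZero.log (MonoidWithZeroHom.ValueGroup₀.embedding γ.1) - 1), trivial, ?_⟩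
      intro f hf
      change Valued.v.restrict f < γ.1
      rw [Valuation.restrict_lt_iff_lt_embedding]
      refine lt_of_le_of_lt ((LaurentSeries.valuation_le_iff_coeff_lt_eq_zero ℂ).2 hf) ?_
      rw [← WithZero.lt_log_iff_exp_lt hne]
      simp
    · rintro N -
      have hx : Valued.v (HahnSeries.single (N - 1) (1 : ℂ) : LaurentSeries ℂ)
          = WithZero.exp (-(N - 1)) := LaurentSeries.valuation_single_zpow ℂ (N - 1)
      have hne : (Valued.v : Valuation (LaurentSeries ℂ) _).restrict
          (HahnSeries.single (N - 1) (1 : ℂ)) ≠ 0 := by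
        rw [Ne, Valuation.restrict_eq_zero_iff, hx]
        exact WithZero.exp_ne_zero
      refine ⟨Units.mk0 _ hne, trivial, ?_⟩
      intro f hf n hn
      have hf' : Valued.v f < WithZero.exp (-(N - 1)) := by
        rw [← hx]
        exact (Valuation.restrict_lt_iff _).1 hf
      have hf2 : Valued.v f ≤ WithZero.exp (-N) := by
        by_cases h0 : Valued.v f = 0
        · rw [h0]; exact zero_le
        · rw [← WithZero.log_le_iff_le_exp h0]
          rw [← WithZero.log_lt_iff_lt_exp h0] at hf'
          omega
      exact LaurentSeries.coeff_zero_of_lt_valuation ℂ hf2 hn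
  exact h0.comap _

instance : ContinuousConstSMul ℂ HPrime where
  continuous_const_smul c := by
    refine Continuous.subtype_mk ?_ _
    have : (fun x : HPrime => c • (x : LaurentSeries ℂ))
        = fun x : HPrime => HahnSeries.C c * (x : LaurentSeries ℂ) := by
      funext x
      rw [HahnSeries.C_mul_eq_smul]
    change Continuous (fun x : HPrime => c • (x : LaurentSeries ℂ))
    rw [this]
    exact continuous_const.mul continuous_subtype_val

/-! ### The symplectic Lie algebra -/

/-- Endomorphisms of `H'` form a Lie algebra under the commutator. -/
instance : LieRing (Module.End ℂ HPrime) := LieRing.ofAssociativeRing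

/-- `gl_1`: the one-dimensional abelian Lie algebra. -/
instance : LieRing ℂ := LieRing.ofAssociativeRing

instance : IsLieAbelian ℂ := ⟨fun x y => by rw [LieRing.of_associative_ring_bracket, mul_comm, sub_self]⟩


/-- `sp(H')`: the Lie algebra of continuous linear endomorphisms `X` of `H'` with
`⟨X a, b⟩ + ⟨a, X b⟩ = 0`. -/
def sp : LieSubalgebra ℂ (Module.End ℂ HPrime) where
  carrier := {X | Continuous X ∧ ∀ f g : HPrime, symp (X f) g + symp f (X g) = 0}
  add_mem' := by
    rintro X Y ⟨hX, hX'⟩ ⟨hY, hY'⟩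
    refine ⟨hX.add hY, fun f g => ?_⟩
    have h1 := hX' f g
    have h2 := hY' f g
    simp only [LinearMap.add_apply, map_add]
    linear_combination h1 + h2
  zero_mem' := ⟨continuous_const, fun f g => by simp⟩
  smul_mem' := by
    rintro c X ⟨hX, hX'⟩
    refine ⟨hX.const_smul c, fun f g => ?_⟩
    have h1 := hX' f g
    simp only [LinearMap.smul_apply, map_smul, smul_eq_mul]
    linear_combination c * h1
  lie_mem' := by
    rintro X Y ⟨hX, hX'⟩ ⟨hY, hY'⟩
    refine ⟨(hX.comp hY).sub (hY.comp hX), fun f g => ?_⟩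
    rw [LieRing.of_associative_ring_bracket]
    simp only [LinearMap.sub_apply, Module.End.mul_apply, map_sub]
    linear_combination hX' (Y f) g - hY' f (X g) - hY' (X f) g + hX' f (Y g)

/-- The neighbourhoods `{X | X (t ^ (-N) ℂ⟦t⟧ ∩ H') ⊆ t ^ N ℂ⟦t⟧}` of `0` in `sp(H')`. -/
def spNhd (N : ℕ) : Set sp :=
  {X | ∀ f ∈ lattice (-(N : ℤ)), (X : Module.End ℂ HPrime) f ∈ lattice N}

/-- The topology of `sp(H')`: uniform convergence on the lattices `t ^ M ℂ⟦t⟧`, which is the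
compact-open topology. -/
abbrev spBasis : AddGroupFilterBasis sp :=
  addGroupFilterBasisOfComm (Set.range spNhd) (Set.range_nonempty _)
    (by
      rintro _ _ ⟨m, rfl⟩ ⟨n, rfl⟩
      refine ⟨_, ⟨max m n, rfl⟩, fun X hX => ⟨fun f hf => ?_, fun f hf => ?_⟩⟩
      · exact lattice_anti (by simp) (hX f (lattice_anti (by simp) hf))
      · exact lattice_anti (by simp) (hX f (lattice_anti (by simp) hf)))
    (by rintro _ ⟨m, rfl⟩ f _; exact Submodule.zero_mem _)
    (by
      rintro _ ⟨m, rfl⟩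
      refine ⟨_, ⟨m, rfl⟩, ?_⟩
      rintro _ ⟨X, hX, Y, hY, rfl⟩ f hf
      exact Submodule.add_mem _ (hX f hf) (hY f hf))
    (by
      rintro _ ⟨m, rfl⟩
      exact ⟨_, ⟨m, rfl⟩, fun X hX f hf => Submodule.neg_mem _ (hX f hf)⟩)

instance : TopologicalSpace sp := spBasis.topology

/-! ### The two-cocycle `ψ` -/

/-- The trace of an endomorphism of `H'` with respect to the topological basis `b_n`; it is used
only where all but finitely many diagonal entries vanish. -/
def trace (T : Module.End ℂ HPrime) : ℂ := ∑ᶠ n : ℤ, (T (b n) : LaurentSeries ℂ).coeff n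

/-- `ψ(A, B) = Tr (π_+ A π_- B π_+ - π_+ B π_- A π_+)`. -/
def psi (A B : Module.End ℂ HPrime) : ℂ :=
  trace (piPlus * A * piMinus * B * piPlus - piPlus * B * piMinus * A * piPlus)

/-- Continuity in terms of lattices. -/
def IsCts (X : Module.End ℂ HPrime) : Prop := ∀ m, ∃ n, ∀ f ∈ lattice n, X f ∈ lattice m

theorem IsCts.of_continuous {X : Module.End ℂ HPrime} (hX : Continuous X) : IsCts X := by
  intro m
  have h : Tendsto X (𝓝 0) (𝓝 0) := by simpa using hX.tendsto 0
  obtain ⟨n, -, hn⟩ := (nhds_zero_basis.tendsto_iff nhds_zero_basis).1 h m trivial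
  exact ⟨n, hn⟩

theorem IsCts.mul {X Y : Module.End ℂ HPrime} (hX : IsCts X) (hY : IsCts Y) : IsCts (X * Y) := by
  intro m
  obtain ⟨n, hn⟩ := hX m
  obtain ⟨k, hk⟩ := hY n
  exact ⟨k, fun f hf => hn _ (hk f hf)⟩

theorem sp_isCts (X : sp) : IsCts X := IsCts.of_continuous X.2.1

theorem coeff_piMinus (f : HPrime) (n : ℤ) :
    (piMinus f : LaurentSeries ℂ).coeff n
      = if n < 0 then (f : LaurentSeries ℂ).coeff n else 0 := by
  change (HahnSeries.truncLT 0 (f : LaurentSeries ℂ)).coeff n = _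
  split_ifs with h
  · exact HahnSeries.coeff_truncLT_of_lt h _
  · exact HahnSeries.coeff_truncLT_of_le (not_lt.1 h) _

theorem coeff_piPlus (f : HPrime) (n : ℤ) :
    (piPlus f : LaurentSeries ℂ).coeff n
      = if n < 0 then 0 else (f : LaurentSeries ℂ).coeff n := by
  change ((f : LaurentSeries ℂ) - (piMinus f : LaurentSeries ℂ)).coeff n = _
  rw [HahnSeries.coeff_sub, coeff_piMinus]
  split_ifs <;> simp

theorem piMinus_isCts : IsCts piMinus := fun m => ⟨m, fun f hf n hn => by
  rw [coeff_piMinus, hf n hn, ite_self]⟩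

theorem piPlus_isCts : IsCts piPlus := fun m => ⟨m, fun f hf n hn => by
  rw [coeff_piPlus, hf n hn, ite_self]⟩

theorem piMinus_eq : piMinus = 1 - piPlus := by
  have : (1 : Module.End ℂ HPrime) - ((1 : Module.End ℂ HPrime) - piMinus) = piMinus :=
    sub_sub_cancel _ _
  exact this.symm

theorem piPlus_mul_self : piPlus * piPlus = piPlus := by
  refine LinearMap.ext fun f => HPrime.ext fun n => ?_
  change (piPlus (piPlus f) : LaurentSeries ℂ).coeff n = (piPlus f : LaurentSeries ℂ).coeff n
  rw [coeff_piPlus, coeff_piPlus]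
  split_ifs <;> rfl

/-- Endomorphisms that kill some lattice and take values in some lattice. -/
def IsNuc (T : Module.End ℂ HPrime) : Prop :=
  ∃ N : ℤ, (∀ f ∈ lattice N, T f = 0) ∧ ∀ f, T f ∈ lattice (-N)

theorem IsNuc.add {S T : Module.End ℂ HPrime} (hS : IsNuc S) (hT : IsNuc T) : IsNuc (S + T) := by
  obtain ⟨m, h1, h2⟩ := hS
  obtain ⟨n, h3, h4⟩ := hT
  refine ⟨max m n, fun f hf => ?_, fun f => ?_⟩
  · rw [LinearMap.add_apply, h1 f (lattice_anti (le_max_left _ _) hf),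
      h3 f (lattice_anti (le_max_right _ _) hf), add_zero]
  · exact Submodule.add_mem _ (lattice_anti (by simp) (h2 f)) (lattice_anti (by simp) (h4 f))

theorem IsNuc.smul {T : Module.End ℂ HPrime} (hT : IsNuc T) (c : ℂ) : IsNuc (c • T) := by
  obtain ⟨n, h3, h4⟩ := hT
  refine ⟨n, fun f hf => ?_, fun f => Submodule.smul_mem _ _ (h4 f)⟩
  rw [LinearMap.smul_apply, h3 f hf, smul_zero]

theorem IsNuc.neg {T : Module.End ℂ HPrime} (hT : IsNuc T) : IsNuc (-T) := by
  obtain ⟨n, h3, h4⟩ := hT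
  refine ⟨n, fun f hf => ?_, fun f => Submodule.neg_mem _ (h4 f)⟩
  rw [LinearMap.neg_apply, h3 f hf, neg_zero]

theorem IsNuc.sub {S T : Module.End ℂ HPrime} (hS : IsNuc S) (hT : IsNuc T) : IsNuc (S - T) := by
  rw [sub_eq_add_neg]; exact hS.add hT.neg

theorem val_sum {ι : Type} (s : Finset ι) (F : ι → HPrime) (n : ℤ) :
    (∑ i ∈ s, F i).val.coeff n = ∑ i ∈ s, (F i).val.coeff n := by
  classical
  induction s using Finset.induction_on with
  | empty => simp
  | insert a s ha ih => rw [Finset.sum_insert ha, Finset.sum_insert ha, HPrime.val_add,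
      HahnSeries.coeff_add, ih]

theorem expand {f : HPrime} {m : ℤ} (hf : f ∈ lattice m) (n : ℤ) :
    f - ∑ k ∈ Finset.Ico m n, f.val.coeff k • b k ∈ lattice n := by
  intro i hi
  rw [HPrime.val_sub, HahnSeries.coeff_sub, val_sum]
  simp only [HPrime.val_smul, HahnSeries.coeff_smul, coeff_b, smul_eq_mul]
  rw [Finset.sum_eq_single i]
  · by_cases h0 : i = 0
    · subst h0; simp [coeff_zero_eq]
    · simp [h0]
  · intro k _ hk
    rw [if_neg (fun h => hk h.1.symm), mul_zero]
  · intro h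
    rw [hf i (by simp only [Finset.mem_Ico, not_and, not_lt] at h; by_contra h'; have := h (not_lt.1 h'); omega),
      zero_mul]

/-- A continuous endomorphism maps every lattice into some lattice. -/
theorem IsCts.exists_lattice {X : Module.End ℂ HPrime} (hX : IsCts X) (m : ℤ) :
    ∃ n, ∀ f ∈ lattice m, X f ∈ lattice n := by
  obtain ⟨n₀, hn₀⟩ := hX 0
  choose N hN using fun k => exists_mem_lattice (X (b k))
  obtain ⟨n, hn⟩ : ∃ n : ℤ, ∀ k ∈ insert 0 ((Finset.Ico m n₀).image N), n ≤ k :=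
    ⟨(insert 0 ((Finset.Ico m n₀).image N)).min' ⟨0, Finset.mem_insert_self _ _⟩,
      fun k hk => Finset.min'_le _ k hk⟩
  refine ⟨n, fun f hf => ?_⟩
  have h := hn₀ _ (expand hf n₀)
  rw [map_sub, map_sum] at h
  have h2 : ∑ k ∈ Finset.Ico m n₀, X (f.val.coeff k • b k) ∈ lattice n := by
    refine Submodule.sum_mem _ fun k hk => ?_
    rw [map_smul]
    refine Submodule.smul_mem _ _ (lattice_anti (hn _ ?_) (hN k))
    exact Finset.mem_insert_of_mem (Finset.mem_image_of_mem _ hk)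
  have h3 := Submodule.add_mem _ (lattice_anti (hn 0 (Finset.mem_insert_self _ _)) h) h2
  rwa [sub_add_cancel] at h3

theorem IsNuc.mul_left {X T : Module.End ℂ HPrime} (hX : IsCts X) (hT : IsNuc T) :
    IsNuc (X * T) := by
  obtain ⟨N, h1, h2⟩ := hT
  obtain ⟨n, hn⟩ := hX.exists_lattice (-N)
  refine ⟨max N (-n), fun f hf => ?_, fun f => ?_⟩
  · rw [Module.End.mul_apply, h1 f (lattice_anti (le_max_left _ _) hf), map_zero]
  · exact lattice_anti (by have := le_max_right N (-n); omega) (hn _ (h2 f))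

theorem IsNuc.mul_right {X T : Module.End ℂ HPrime} (hX : IsCts X) (hT : IsNuc T) :
    IsNuc (T * X) := by
  obtain ⟨N, h1, h2⟩ := hT
  obtain ⟨n, hn⟩ := hX N
  refine ⟨max N n, fun f hf => ?_, fun f => ?_⟩
  · exact h1 _ (hn _ (lattice_anti (le_max_right _ _) hf))
  · exact lattice_anti (by have := le_max_left N n; omega) (h2 _)

theorem isNuc_minus_plus {Y : Module.End ℂ HPrime} (hY : IsCts Y) :
    IsNuc (piMinus * Y * piPlus) := by
  obtain ⟨n, hn⟩ := (hY.mul piPlus_isCts) 0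
  obtain ⟨m, hm⟩ := hY.exists_lattice 0
  refine ⟨max n (-m), fun f hf => ?_, fun f => ?_⟩
  · refine HPrime.ext fun k => ?_
    change (piMinus ((Y * piPlus) f)).val.coeff k = (0 : LaurentSeries ℂ).coeff k
    rw [coeff_piMinus, HahnSeries.coeff_zero]
    split_ifs with h
    · exact hn f (lattice_anti (le_max_left _ _) hf) k h
    · rfl
  · intro k hk
    change (piMinus (Y (piPlus f))).val.coeff k = 0
    rw [coeff_piMinus]
    split_ifs
    · refine hm (piPlus f) (fun j hj => ?_) k (by have := le_max_right n (-m); omega)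
      rw [coeff_piPlus, if_pos hj]
    · rfl

theorem isNuc_psi {X Y : Module.End ℂ HPrime} (hX : IsCts X) (hY : IsCts Y) :
    IsNuc (piPlus * X * piMinus * Y * piPlus) := by
  have h := IsNuc.mul_left (piPlus_isCts.mul hX) (isNuc_minus_plus hY)
  simpa only [mul_assoc] using h

theorem IsNuc.finite_support {T : Module.End ℂ HPrime} (hT : IsNuc T) :
    (Function.support fun n : ℤ => (T (b n)).val.coeff n).Finite := by
  obtain ⟨N, h1, h2⟩ := hT
  refine (Set.finite_Ico (-N) N).subset fun n hn => ?_
  rw [Function.mem_support] at hn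
  by_contra h
  apply hn
  by_cases h' : N ≤ n
  · rw [h1 _ (lattice_anti h' (b_mem n))]; rfl
  · exact h2 _ n (by simp only [Set.mem_Ico, not_and, not_lt] at h; by_contra h3; have := h (not_lt.1 h3); omega)

theorem trace_add {S T : Module.End ℂ HPrime} (hS : IsNuc S) (hT : IsNuc T) :
    trace (S + T) = trace S + trace T :=
  finsum_add_distrib hS.finite_support hT.finite_support

theorem trace_smul (c : ℂ) (T : Module.End ℂ HPrime) : trace (c • T) = c * trace T :=
  (smul_finsum c (fun n : ℤ => (T (b n)).val.coeff n)).symm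

theorem trace_zero : trace 0 = 0 := by
  simpa using trace_smul 0 0

theorem trace_sub {S T : Module.End ℂ HPrime} (hS : IsNuc S) (hT : IsNuc T) :
    trace (S - T) = trace S - trace T := by
  rw [sub_eq_add_neg, ← neg_one_smul ℂ T, trace_add hS (hT.smul _), trace_smul]; ring

theorem trace_comm {X T : Module.End ℂ HPrime} (hX : IsCts X) (hT : IsNuc T) :
    trace (X * T) = trace (T * X) := by
  obtain ⟨N, h1, h2⟩ := hT
  obtain ⟨M₁, hM₁⟩ := hX N
  obtain ⟨M₂, hM₂⟩ := hX.exists_lattice (-N)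
  set M := max N (max M₁ (-M₂)) with hM
  have hNM : N ≤ M := le_max_left _ _
  have hM1 : M₁ ≤ M := (le_max_left _ _).trans (le_max_right _ _)
  have hM2 : -M₂ ≤ M := (le_max_right _ _).trans (le_max_right _ _)
  have e1 : trace (T * X) = ∑ i ∈ Finset.Ico (-N) M, ∑ k ∈ Finset.Ico (-M) N,
      (X (b i)).val.coeff k * (T (b k)).val.coeff i := by
    have hsupp : (Function.support fun n : ℤ => ((T * X) (b n)).val.coeff n) ⊆
        (Finset.Ico (-N) M : Finset ℤ) := by
      intro n hn
      rw [Function.mem_support] at hn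
      rw [Finset.coe_Ico, Set.mem_Ico]
      by_contra h
      apply hn
      by_cases h' : M ≤ n
      · rw [Module.End.mul_apply, h1 _ (hM₁ _ (lattice_anti (hM1.trans h') (b_mem n)))]; rfl
      · exact h2 _ n (by omega)
    unfold trace
    rw [finsum_eq_sum_of_support_subset _ hsupp]
    refine Finset.sum_congr rfl fun i hi => ?_
    rw [Finset.mem_Ico] at hi
    have hXi : X (b i) ∈ lattice (-M) :=
      lattice_anti (by omega) (hM₂ _ (lattice_anti hi.1 (b_mem i)))
    have h := h1 _ (expand hXi N)
    rw [map_sub, sub_eq_zero] at h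
    rw [Module.End.mul_apply, h, map_sum, val_sum]
    refine Finset.sum_congr rfl fun k _ => ?_
    rw [map_smul, HPrime.val_smul, HahnSeries.coeff_smul, smul_eq_mul]
  have e2 : trace (X * T) = ∑ k ∈ Finset.Ico (-M) N, ∑ i ∈ Finset.Ico (-N) M,
      (X (b i)).val.coeff k * (T (b k)).val.coeff i := by
    have hsupp : (Function.support fun n : ℤ => ((X * T) (b n)).val.coeff n) ⊆
        (Finset.Ico (-M) N : Finset ℤ) := by
      intro n hn
      rw [Function.mem_support] at hn
      rw [Finset.coe_Ico, Set.mem_Ico]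
      by_contra h
      apply hn
      by_cases h' : N ≤ n
      · rw [Module.End.mul_apply, h1 _ (lattice_anti h' (b_mem n)), map_zero]; rfl
      · exact hM₂ _ (h2 _) n (by omega)
    unfold trace
    rw [finsum_eq_sum_of_support_subset _ hsupp]
    refine Finset.sum_congr rfl fun k hk => ?_
    rw [Finset.mem_Ico] at hk
    have h := hM₁ _ (lattice_anti hM1 (expand (h2 (b k)) M)) k hk.2
    rw [map_sub, HPrime.val_sub, HahnSeries.coeff_sub, sub_eq_zero] at h
    rw [Module.End.mul_apply, h, map_sum, val_sum]
    refine Finset.sum_congr rfl fun i _ => ?_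
    rw [map_smul, HPrime.val_smul, HahnSeries.coeff_smul, smul_eq_mul, mul_comm]
  rw [e1, e2, Finset.sum_comm]

theorem psi_add_left {A A' B : Module.End ℂ HPrime} (hA : IsCts A) (hA' : IsCts A')
    (hB : IsCts B) : psi (A + A') B = psi A B + psi A' B := by
  unfold psi
  rw [← trace_add ((isNuc_psi hA hB).sub (isNuc_psi hB hA))
    ((isNuc_psi hA' hB).sub (isNuc_psi hB hA'))]
  congr 1
  noncomm_ring

theorem psi_smul_left (c : ℂ) (A B : Module.End ℂ HPrime) : psi (c • A) B = c * psi A B := by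
  unfold psi
  rw [← trace_smul]
  congr 1
  simp only [mul_smul_comm, smul_mul_assoc, smul_sub]

theorem psi_skew {A B : Module.End ℂ HPrime} (hA : IsCts A) (hB : IsCts B) :
    psi B A = - psi A B := by
  unfold psi
  rw [trace_sub (isNuc_psi hB hA) (isNuc_psi hA hB), trace_sub (isNuc_psi hA hB) (isNuc_psi hB hA)]
  ring

theorem psi_self (A : Module.End ℂ HPrime) : psi A A = 0 := by
  unfold psi
  rw [sub_self, trace_zero]

theorem psi_cocycle {X Y Z : Module.End ℂ HPrime} (hX : IsCts X) (hY : IsCts Y) (hZ : IsCts Z) :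
    psi X (Y * Z - Z * Y) = psi (X * Y - Y * X) Z + psi Y (X * Z - Z * X) := by
  have key : ∀ {U V : Module.End ℂ HPrime}, IsCts U → IsCts V → IsNuc
      (piPlus * U * piMinus * V * piPlus - piPlus * V * piMinus * U * piPlus) :=
    fun hU hV => (isNuc_psi hU hV).sub (isNuc_psi hV hU)
  have hcomm : ∀ {U V : Module.End ℂ HPrime}, IsCts U → IsCts V → IsCts (U * V - V * U) := by
    intro U V hU hV m
    obtain ⟨n₁, h₁⟩ := hU.mul hV m
    obtain ⟨n₂, h₂⟩ := hV.mul hU m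
    exact ⟨max n₁ n₂, fun f hf => Submodule.sub_mem _
      (h₁ f (lattice_anti (le_max_left _ _) hf)) (h₂ f (lattice_anti (le_max_right _ _) hf))⟩
  have hx := (piPlus_isCts.mul hX).mul piPlus_isCts
  have hy := (piPlus_isCts.mul hY).mul piPlus_isCts
  have hz := (piPlus_isCts.mul hZ).mul piPlus_isCts
  have c0 : ∀ {U V : Module.End ℂ HPrime}, IsCts U → IsNuc V → trace (U * V - V * U) = 0 := by
    intro U V hU hV
    rw [trace_sub (hV.mul_left hU) (hV.mul_right hU), trace_comm hU hV, sub_self]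
  have cn : ∀ {U V : Module.End ℂ HPrime}, IsCts U → IsNuc V → IsNuc (U * V - V * U) :=
    fun hU hV => (hV.mul_left hU).sub (hV.mul_right hU)
  have hP : ∀ x : Module.End ℂ HPrime, piPlus * (piPlus * x) = piPlus * x := fun x => by
    rw [← mul_assoc, piPlus_mul_self]
  rw [← sub_eq_zero, ← sub_sub]
  unfold psi
  rw [← trace_sub (key hX (hcomm hY hZ)) (key (hcomm hX hY) hZ),
    ← trace_sub ((key hX (hcomm hY hZ)).sub (key (hcomm hX hY) hZ)) (key hY (hcomm hX hZ))]
  have e := trace_sub ((cn hy (key hX hZ)).sub (cn hx (key hY hZ))) (cn hz (key hX hY))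
  rw [trace_sub (cn hy (key hX hZ)) (cn hx (key hY hZ)), c0 hy (key hX hZ), c0 hx (key hY hZ),
    c0 hz (key hX hY)] at e
  simp only [sub_zero] at e
  rw [← e]
  congr 1
  simp only [piMinus_eq, mul_sub, sub_mul, mul_assoc, mul_one, hP]
  abel

/-- The restriction of `ψ` to `sp(H')`, as a bilinear form. -/
def psiSp : sp →ₗ[ℂ] sp →ₗ[ℂ] ℂ :=
  LinearMap.mk₂ ℂ (fun X Y => psi X Y)
    (fun X X' Y => psi_add_left (sp_isCts X) (sp_isCts X') (sp_isCts Y))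
    (fun c X Y => psi_smul_left c X Y)
    (fun X Y Y' => by
      have h := psi_add_left (sp_isCts Y) (sp_isCts Y') (sp_isCts X)
      rw [psi_skew (sp_isCts X) (sp_isCts Y), psi_skew (sp_isCts X) (sp_isCts Y')] at h
      have h2 := psi_skew (sp_isCts X) (sp_isCts (Y + Y'))
      change psi X ((Y : Module.End ℂ HPrime) + Y') = _
      change psi ((Y : Module.End ℂ HPrime) + Y') X = - psi X ((Y : Module.End ℂ HPrime) + Y') at h2
      linear_combination h2 - h)
    (fun c X Y => by
      have h := psi_smul_left c Y X
      have h2 := psi_skew (sp_isCts X) (sp_isCts (c • Y))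
      have h3 := psi_skew (sp_isCts X) (sp_isCts Y)
      change psi (c • (Y : Module.End ℂ HPrime)) X = - psi X (c • (Y : Module.End ℂ HPrime)) at h2
      change psi X (c • (Y : Module.End ℂ HPrime)) = c * psi X Y
      linear_combination h2 - h - c * h3)

/-! ### The semidirect product `sp(H') ⋉ H'` -/

/-- `H'` as an abelian Lie algebra. -/
instance : LieRing HPrime where
  bracket _ _ := 0
  add_lie _ _ _ := (add_zero _).symm
  lie_add _ _ _ := (add_zero _).symm
  lie_self _ := rfl
  leibniz_lie _ _ _ := (add_zero _).symm

instance : LieAlgebra ℂ HPrime where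
  lie_smul _ _ _ := (smul_zero _).symm

/-- The action of `sp(H')` on `H'`. -/
def spAction : sp →ₗ⁅ℂ⁆ LieDerivation ℂ HPrime HPrime where
  toFun X :=
    { toLinearMap := (X : Module.End ℂ HPrime)
      leibniz' := fun f g => by
        change (X : Module.End ℂ HPrime) 0 = 0 - 0
        rw [map_zero, sub_zero] }
  map_add' _ _ := rfl
  map_smul' _ _ := rfl
  map_lie' := by
    intro X Y
    ext f
    rfl

/-- `sp(H') ⋉ H'`, with `[X + f, Y + g] = XY - YX + X(g) - Y(f)`; an element `X + f` has
`left` component `f` and `right` component `X`. -/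
abbrev SpH : Type := LieAlgebra.SemiDirectSum HPrime sp spAction

theorem SpH.lie_def (x y : SpH) : ⁅x, y⁆ =
    ⟨(x.right : Module.End ℂ HPrime) y.left - (y.right : Module.End ℂ HPrime) x.left,
      ⁅x.right, y.right⁆⟩ := by
  rw [LieAlgebra.SemiDirectSum.lie_eq_mk]
  congr 1
  change 0 + _ - _ = _
  rw [zero_add]
  rfl

/-- The product topology. -/
instance : TopologicalSpace SpH :=
  TopologicalSpace.induced (fun x => (x.right, x.left)) inferInstance

/-! ### Continuous central extensions by `gl_1` and splittings -/

/-- An extension `0 → gl_1 → E → g → 0` of Lie algebras is a continuous central extension if it is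
central, `E` is a (Hausdorff) topological Lie algebra, the projection is continuous, and the
extension splits as an extension of topological vector spaces, so that it is described by a
continuous two-cocycle. No topology on `gl_1` is fixed: it has the one induced from `E`. -/
structure IsContinuousCentral {g : Type} [LieRing g] [LieAlgebra ℂ g] [TopologicalSpace g]
    (E : LieAlgebra.Extension ℂ ℂ g) [TopologicalSpace E.L] : Prop where
  central : ∀ (c : ℂ) (x : E.L), ⁅E.incl c, x⁆ = 0
  t2 : T2Space E.L
  topologicalAddGroup : IsTopologicalAddGroup E.L
  continuous_smul : ContinuousConstSMul ℂ E.L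
  continuous_lie : Continuous fun x : E.L × E.L => ⁅x.1, x.2⁆
  continuous_proj : Continuous E.proj
  exists_section : ∃ s : g →ₗ[ℂ] E.L, Continuous s ∧ ∀ x, E.proj (s x) = x

/-- The extension `E` of `g` splits over the subalgebra `k`: there is a continuous homomorphism of
Lie algebras `k → E` lifting the inclusion `k → g`. -/
def SplitsOver {g : Type} [LieRing g] [LieAlgebra ℂ g] [TopologicalSpace g]
    (E : LieAlgebra.Extension ℂ ℂ g) [TopologicalSpace E.L] (k : LieSubalgebra ℂ g) : Prop :=
  ∃ s : k →ₗ⁅ℂ⁆ E.L, Continuous s ∧ ∀ x : k, E.proj (s x) = x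

/-! ### The extensions `mp(H')` of `sp(H')` and `Ũ₂(H)` of `sp(H') ⋉ H'` -/

section TrivialModules

/-- `ℂ` as a trivial module. -/
instance : LieRingModule sp ℂ where
  bracket _ _ := 0
  add_lie _ _ _ := (add_zero _).symm
  lie_add _ _ _ := (add_zero _).symm
  leibniz_lie _ _ _ := (add_zero _).symm

instance : LieModule.IsTrivial sp ℂ := ⟨fun _ _ => rfl⟩

instance : LieModule ℂ sp ℂ where
  smul_lie _ _ _ := (smul_zero _).symm
  lie_smul _ _ _ := (smul_zero _).symm

/-- `ℂ` as a trivial module. -/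
instance : LieRingModule SpH ℂ where
  bracket _ _ := 0
  add_lie _ _ _ := (add_zero _).symm
  lie_add _ _ _ := (add_zero _).symm
  leibniz_lie _ _ _ := (add_zero _).symm

instance : LieModule.IsTrivial SpH ℂ := ⟨fun _ _ => rfl⟩

instance : LieModule ℂ SpH ℂ where
  smul_lie _ _ _ := (smul_zero _).symm
  lie_smul _ _ _ := (smul_zero _).symm

end TrivialModules

open LieModule.Cohomology

theorem psiSp_cocycle (X Y Z : sp) : psiSp X ⁅Y, Z⁆ = psiSp ⁅X, Y⁆ Z + psiSp Y ⁅X, Z⁆ :=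
  psi_cocycle (sp_isCts X) (sp_isCts Y) (sp_isCts Z)

/-- The two-cocycle `-ψ/2` on `sp(H')`. -/
def mpCocycle : twoCocycle ℂ sp ℂ :=
  ⟨⟨(-1 / 2 : ℂ) • psiSp, fun X => by
      change (-1 / 2 : ℂ) * psi X X = 0
      rw [psi_self, mul_zero]⟩, by
    rw [mem_twoCocycle_iff_of_trivial]
    intro X Y Z
    change (-1 / 2 : ℂ) * psiSp X ⁅Y, Z⁆
      = (-1 / 2 : ℂ) * psiSp ⁅X, Y⁆ Z + (-1 / 2 : ℂ) * psiSp Y ⁅X, Z⁆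
    rw [psiSp_cocycle]; ring⟩

/-- The bilinear form `c(X + f, Y + g) = -ψ(X, Y)/2 + ⟨f, g⟩` on `sp(H') ⋉ H'`. -/
def weylForm : SpH →ₗ[ℂ] SpH →ₗ[ℂ] ℂ :=
  LinearMap.mk₂ ℂ (fun x y => -1 / 2 * psiSp x.right y.right + symp x.left y.left)
    (fun x x' y => by
      change -1 / 2 * psiSp (x.right + x'.right) y.right + symp (x.left + x'.left) y.left = _
      rw [map_add, map_add, LinearMap.add_apply, LinearMap.add_apply]; ring)
    (fun c x y => by
      change -1 / 2 * psiSp (c • x.right) y.right + symp (c • x.left) y.left = c * _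
      rw [map_smul, map_smul, LinearMap.smul_apply, LinearMap.smul_apply, smul_eq_mul,
        smul_eq_mul]; ring)
    (fun x y y' => by
      change -1 / 2 * psiSp x.right (y.right + y'.right) + symp x.left (y.left + y'.left) = _
      rw [map_add, map_add]; ring)
    (fun c x y => by
      change -1 / 2 * psiSp x.right (c • y.right) + symp x.left (c • y.left) = c * _
      rw [map_smul, map_smul, smul_eq_mul, smul_eq_mul]; ring)

theorem symp_eq_sum {f g : HPrime} {M : ℤ} (hf : f ∈ lattice (-M)) (hg : g ∈ lattice (-M)) :
    symp f g = ∑ n ∈ Finset.Icc (-M) M, (n : ℂ) * f.val.coeff n * g.val.coeff (-n) := by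
  change -(f.val * LaurentSeries.derivative ℂ g.val).coeff (-1) = _
  rw [HahnSeries.coeff_mul]
  have hinj : Set.InjOn Prod.fst
      (Finset.antidiagonal f.val.isPWO_support
        (LaurentSeries.derivative ℂ g.val).isPWO_support (-1) : Set (ℤ × ℤ)) := by
    rintro ⟨a, b⟩ h ⟨c, d⟩ h' h2
    rw [Finset.mem_coe, Finset.mem_antidiagonal] at h h'
    have h3 := h.2.2
    have h4 := h'.2.2
    simp only at h2 h3 h4
    ext <;> simp <;> omega
  have hterm : ∀ p ∈ Finset.antidiagonal f.val.isPWO_support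
      (LaurentSeries.derivative ℂ g.val).isPWO_support (-1),
      f.val.coeff p.1 * (LaurentSeries.derivative ℂ g.val).coeff p.2
        = -((p.1 : ℂ) * f.val.coeff p.1 * g.val.coeff (-p.1)) := by
    intro p hp
    rw [Finset.mem_antidiagonal] at hp
    have hp2 : p.2 = -1 - p.1 := by have := hp.2.2; omega
    have h1 : -1 - p.1 + ((1 : ℕ) : ℤ) = -p.1 := by push_cast; ring
    rw [LaurentSeries.derivative_apply, LaurentSeries.hasseDeriv_coeff, hp2, h1,
      Ring.choose_one_right, zsmul_eq_mul]
    push_cast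
    ring
  rw [Finset.sum_congr rfl hterm, Finset.sum_neg_distrib, neg_neg,
    ← Finset.sum_image (f := fun n : ℤ => (n : ℂ) * f.val.coeff n * g.val.coeff (-n)) hinj]
  have hf0 : ∀ n < -M, f.val.coeff n = 0 := hf
  have hg0 : ∀ n < -M, g.val.coeff n = 0 := hg
  refine Finset.sum_subset_zero_on_sdiff ?_ ?_ (fun _ _ => rfl)
  · intro n hn
    obtain ⟨p, hp, rfl⟩ := Finset.mem_image.1 hn
    have h := hterm p hp
    rw [Finset.mem_antidiagonal] at hp
    rw [Finset.mem_Icc]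
    by_contra hc
    have hne := mul_ne_zero (HahnSeries.mem_support _ _ |>.1 hp.1)
      (HahnSeries.mem_support _ _ |>.1 hp.2.1)
    apply hne
    rw [h]
    by_cases h1 : p.1 < -M
    · rw [hf0 _ h1]; ring
    · rw [hg0 (-p.1) (by omega)]; ring
  · intro n hn
    rw [Finset.mem_sdiff, Finset.mem_image] at hn
    by_contra hc
    apply hn.2
    have hn0 : (n : ℂ) ≠ 0 := fun h => hc (by rw [h]; ring)
    have hfn : f.val.coeff n ≠ 0 := fun h => hc (by rw [h]; ring)
    have hgn : g.val.coeff (-n) ≠ 0 := fun h => hc (by rw [h]; ring)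
    refine ⟨(n, -1 - n), ?_, rfl⟩
    rw [Finset.mem_antidiagonal]
    refine ⟨hfn, ?_, by simp⟩
    rw [HahnSeries.mem_support, LaurentSeries.derivative_apply, LaurentSeries.hasseDeriv_coeff]
    have h1 : -1 - n + ((1 : ℕ) : ℤ) = -n := by push_cast; ring
    rw [h1, Ring.choose_one_right, zsmul_eq_mul]
    push_cast
    exact mul_ne_zero (neg_ne_zero.2 hn0) hgn

theorem symp_skew (f g : HPrime) : symp g f = - symp f g := by
  obtain ⟨m, hm⟩ := exists_mem_lattice f
  obtain ⟨n, hn⟩ := exists_mem_lattice g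
  have hf := lattice_anti (min_le_left m n) hm
  have hg := lattice_anti (min_le_right m n) hn
  rw [← neg_neg (min m n)] at hf hg
  rw [symp_eq_sum hf hg, symp_eq_sum hg hf, ← Finset.sum_neg_distrib]
  refine Finset.sum_nbij' (fun k => -k) (fun k => -k) ?_ ?_ ?_ ?_ ?_
  · intro k hk; rw [Finset.mem_Icc] at hk ⊢; omega
  · intro k hk; rw [Finset.mem_Icc] at hk ⊢; omega
  · intro k _; exact neg_neg k
  · intro k _; exact neg_neg k
  · intro k _; rw [neg_neg]; push_cast; ring

/-- The two-cocycle `c(X + f, Y + g) = -ψ(X, Y)/2 + ⟨f, g⟩` on `sp(H') ⋉ H'`. -/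
def weylCocycle : twoCocycle ℂ SpH ℂ :=
  ⟨⟨weylForm, fun x => by
      change -1 / 2 * psi x.right x.right + symp x.left x.left = 0
      have h := symp_skew x.left x.left
      rw [psi_self]
      linear_combination (1 / 2 : ℂ) * h⟩, by
    rw [mem_twoCocycle_iff_of_trivial]
    intro x y z
    simp only [SpH.lie_def]
    change -1 / 2 * psiSp x.right ⁅y.right, z.right⁆ + symp x.left (y.right.1 z.left - z.right.1 y.left)
      = (-1 / 2 * psiSp ⁅x.right, y.right⁆ z.right + symp (x.right.1 y.left - y.right.1 x.left) z.left)
        + (-1 / 2 * psiSp y.right ⁅x.right, z.right⁆ + symp y.left (x.right.1 z.left - z.right.1 x.left))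
    rw [psiSp_cocycle]
    simp only [map_sub, LinearMap.sub_apply]
    have h1 := y.right.2.2 x.left z.left
    have h2 := x.right.2.2 y.left z.left
    have h3 := z.right.2.2 x.left y.left
    have h4 := symp_skew (z.right.1 x.left) y.left
    linear_combination h1 - h2 - h3 + h4⟩

/-- The metaplectic extension `0 → gl_1 → mp(H') → sp(H') → 0` given by the cocycle `-ψ/2`. -/
def mp : LieAlgebra.Extension ℂ ℂ sp := LieAlgebra.Extension.ofTwoCocycle mpCocycle

/-- The product topology of `sp(H') × ℂ` with `ℂ` discrete. -/
instance : TopologicalSpace mp.L :=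
  TopologicalSpace.induced (fun x : LieAlgebra.ofTwoCocycle mpCocycle => x.carrier)
    (@instTopologicalSpaceProd sp ℂ _ ⊥)

/-- The extension `0 → gl_1 → Ũ₂(H) → sp(H') ⋉ H' → 0` given by the cocycle
`c(X + f, Y + g) = -ψ(X, Y)/2 + ⟨f, g⟩`. -/
def weylTwo : LieAlgebra.Extension ℂ ℂ SpH := LieAlgebra.Extension.ofTwoCocycle weylCocycle

/-- The product topology of `(sp(H') ⋉ H') × ℂ` with `ℂ` discrete. -/
instance : TopologicalSpace weylTwo.L :=
  TopologicalSpace.induced (fun x : LieAlgebra.ofTwoCocycle weylCocycle => x.carrier)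
    (@instTopologicalSpaceProd SpH ℂ _ ⊥)

/-! ### Lagrangian subspaces and stabilizers -/

/-- `F^⊥` with respect to the symplectic form. -/
def perp (F : Submodule ℂ HPrime) : Submodule ℂ HPrime := symp.orthogonal F

/-- Lagrangian subspaces: `Z^⊥ = Z`, equivalently `Z` is maximal isotropic. -/
def IsLagrangian (Z : Submodule ℂ HPrime) : Prop := perp Z = Z

theorem IsLagrangian.le_perp {Z F : Submodule ℂ HPrime} (hZ : IsLagrangian Z) (hF : F ≤ Z) :
    F ≤ perp F := by
  have h : perp Z ≤ perp F := LinearMap.BilinForm.orthogonal_le hF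
  rw [show perp Z = Z from hZ] at h
  exact hF.trans h

/-- `sp_F(H') = {X ∈ sp(H') | X(F^⊥) ⊆ F}`, for an isotropic subspace `F`. -/
def spF (F : Submodule ℂ HPrime) (hF : F ≤ perp F) : LieSubalgebra ℂ sp where
  carrier := {X | ∀ f ∈ perp F, (X : Module.End ℂ HPrime) f ∈ F}
  add_mem' hX hY f hf := F.add_mem (hX f hf) (hY f hf)
  zero_mem' _ _ := F.zero_mem
  smul_mem' c _ hX f hf := F.smul_mem c (hX f hf)
  lie_mem' hX hY f hf := F.sub_mem (hX _ (hF (hY f hf))) (hY _ (hF (hX f hf)))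

/-- `sp_F(H') ⋉ F`, for an isotropic subspace `F`. -/
def spFH (F : Submodule ℂ HPrime) (hF : F ≤ perp F) : LieSubalgebra ℂ SpH where
  carrier := {x | x.right ∈ spF F hF ∧ x.left ∈ F}
  add_mem' hx hy := ⟨(spF F hF).add_mem hx.1 hy.1, F.add_mem hx.2 hy.2⟩
  zero_mem' := ⟨(spF F hF).zero_mem, F.zero_mem⟩
  smul_mem' c _ hx := ⟨(spF F hF).smul_mem c hx.1, F.smul_mem c hx.2⟩
  lie_mem' {x y} hx hy := by
    rw [SpH.lie_def]
    exact ⟨(spF F hF).lie_mem hx.1 hy.1,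
      F.sub_mem (hx.1 _ (hF hy.2)) (hy.1 _ (hF hx.2))⟩

end

end Metaplectic

namespace Metaplectic

/-! ### Two-cocycles on infinite sum rings -/

section InfiniteSum

/-! The proof reduces the statement to the vanishing of a continuous second cohomology class on the
stabilizer of `Z`. Since `F ⊆ Z = Z^⊥ ⊆ F^⊥`, every `X` in `sp_F(H')` maps `Z` into `F ⊆ Z`, so
`sp_F(H') ⋉ F` lies in the algebra of those `X + f` with `X(Z) ⊆ Z` and `f ∈ Z`. It is enough to
show that a cocycle on `sp(H') ⋉ H'`, restricted to this algebra, is the coboundary of a linear form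
vanishing near `0`; part (1) follows by pulling a cocycle back along `sp(H') ⋉ H' → sp(H')`.

The condition `Z ∩ H'_+ = 0` makes `Z` a complement of `H'_+`: a linear form on `H' / H'_+` killing
the image of `Z` is represented by an element of `H'_+ ∩ Z^⊥ = H'_+ ∩ Z = 0`. Hence `Z ≅ H' / H'_+`
has countable dimension, and `gl(Z)` embeds into `sp(H')`, acting on `H'_+` by minus the adjoint.
The identity of `Z` becomes an element `h`, equal to `1` on `Z` and `-1` on `H'_+`. Under `ad h` the
stabilizer splits into `gl(Z)` in weight 0, `Z` in weight 1 and the maps vanishing on `Z` in weight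
2.

If `x` and `y` have weights `m` and `n`, the cocycle identity gives `(m + n) c(x, y) = c(h, [x,
y])`, so all pairings outside `gl(Z)` come from the linear form `c(h, ·)`, rescaled on each weight.
On `gl(Z)` the weight is 0 and an Eilenberg swindle takes over: `End(Z)` is an infinite sum ring,
because `Z ≅ Z ⊕ Z` and `a` can be repeated infinitely often as `σ(a) = a ⊕ σ(a)`. Each corner `a ⊕
0` is then a commutator with a shift, which gives an explicit primitive of any cocycle
(`InfiniteSum.eq_primitive_commutator`). The two cases are assembled in
`LagrangianFrame.exists_primitive`.

Continuity costs little, as the topologies are linear: a continuous cocycle `c(·, y)` vanishes on an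
open subspace, and the primitives are built from finitely many such forms. For `mp(H')` and `Ũ₂(H)`
it remains to see that `ψ` and the symplectic form are locally constant. -/

/-- An algebra `A` with an isomorphism `A ≃ M₂(A)`, given by `s₀, s₁, t₀, t₁`, and an endomorphism
`σ` with `σ a = s₀ a t₀ + s₁ σ(a) t₁`. -/
structure InfiniteSum (A : Type*) [Ring A] [Algebra ℂ A] where
  (s₀ s₁ t₀ t₁ : A)
  σ : A →ₗ[ℂ] A
  t₀_s₀ : t₀ * s₀ = 1
  t₁_s₁ : t₁ * s₁ = 1
  t₀_s₁ : t₀ * s₁ = 0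
  t₁_s₀ : t₁ * s₀ = 0
  s_t : s₀ * t₀ + s₁ * t₁ = 1
  σ_mul : ∀ a b, σ (a * b) = σ a * σ b
  σ_eq : ∀ a, σ a = s₀ * a * t₀ + s₁ * σ a * t₁

/-- A bilinear form on an associative algebra that is a two-cocycle for the commutator bracket. -/
structure IsCommutatorCocycle {A : Type*} [Ring A] [Algebra ℂ A] (c : A →ₗ[ℂ] A →ₗ[ℂ] ℂ) :
    Prop where
  skew : ∀ x y, c y x = -c x y
  jacobi : ∀ x y z, c (x * y - y * x) z + c (y * z - z * y) x + c (z * x - x * z) y = 0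

variable {A : Type*} [Ring A] [Algebra ℂ A]

/-- The coboundary `(x, y) ↦ l (x y - y x)` of a linear form. -/
def commutatorCoboundary (l : A →ₗ[ℂ] ℂ) : A →ₗ[ℂ] A →ₗ[ℂ] ℂ :=
  (LinearMap.mul ℂ A - (LinearMap.mul ℂ A).flip).compr₂ l

@[simp] theorem commutatorCoboundary_apply (l : A →ₗ[ℂ] ℂ) (x y : A) :
    commutatorCoboundary l x y = l (x * y - y * x) := rfl

theorem IsCommutatorCocycle.sub_coboundary {c : A →ₗ[ℂ] A →ₗ[ℂ] ℂ} (hc : IsCommutatorCocycle c)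
    (l : A →ₗ[ℂ] ℂ) : IsCommutatorCocycle (c - commutatorCoboundary l) where
  skew x y := by
    simp only [LinearMap.sub_apply, commutatorCoboundary_apply]
    rw [hc.skew x y, ← neg_sub (x * y) (y * x), map_neg]
    ring
  jacobi x y z := by
    simp only [LinearMap.sub_apply, commutatorCoboundary_apply]
    have h := hc.jacobi x y z
    have h2 : l ((x * y - y * x) * z - z * (x * y - y * x))
        + l ((y * z - z * y) * x - x * (y * z - z * y))
        + l ((z * x - x * z) * y - y * (z * x - x * z)) = 0 := by
      rw [← map_add, ← map_add, ← map_zero l]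
      congr 1
      noncomm_ring
    linear_combination h - h2

/-- A cocycle vanishes on a commutator and an element commuting with both of its factors. -/
theorem IsCommutatorCocycle.apply_commutator_eq_zero {c : A →ₗ[ℂ] A →ₗ[ℂ] ℂ}
    (hc : IsCommutatorCocycle c) {x y z : A} (hx : x * z = z * x) (hy : y * z = z * y) :
    c (x * y - y * x) z = 0 := by
  have h := hc.jacobi x y z
  rw [hy, hx, sub_self, sub_self] at h
  simpa using h

namespace InfiniteSum

variable (S : InfiniteSum A)

theorem t₀_s₀_mul (a : A) : S.t₀ * (S.s₀ * a) = a := by rw [← mul_assoc, S.t₀_s₀, one_mul]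
theorem t₁_s₁_mul (a : A) : S.t₁ * (S.s₁ * a) = a := by rw [← mul_assoc, S.t₁_s₁, one_mul]
theorem t₀_s₁_mul (a : A) : S.t₀ * (S.s₁ * a) = 0 := by rw [← mul_assoc, S.t₀_s₁, zero_mul]
theorem t₁_s₀_mul (a : A) : S.t₁ * (S.s₀ * a) = 0 := by rw [← mul_assoc, S.t₁_s₀, zero_mul]

theorem σ_s₁ (a : A) : S.σ a * S.s₁ = S.s₁ * S.σ a := by
  nth_rw 1 [S.σ_eq]
  simp [add_mul, mul_assoc, S.t₀_s₁, S.t₁_s₁]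

theorem t₁_σ (a : A) : S.t₁ * S.σ a = S.σ a * S.t₁ := by
  nth_rw 1 [S.σ_eq]
  simp [mul_add, mul_assoc, S.t₁_s₁_mul, S.t₁_s₀_mul]

/-- The swindle: `σ(a)` commutes with the shift `s₁`, while `s₁ σ(a) t₁` is `σ(a)` with its first
copy of `a` removed. -/
theorem corner_eq (a : A) :
    S.s₀ * a * S.t₀ = S.σ a * S.t₁ * S.s₁ - S.s₁ * (S.σ a * S.t₁) := by
  rw [mul_assoc (S.σ a), S.t₁_s₁, mul_one, ← mul_assoc]
  nth_rw 1 [S.σ_eq]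
  rw [add_sub_cancel_right]

/-- The first commutator is the corner `s₀ a t₀`; the second moves that corner back to `a`. So `A`
is perfect as a Lie algebra. -/
theorem eq_add_commutator (a : A) :
    a = (S.σ a * S.t₁ * S.s₁ - S.s₁ * (S.σ a * S.t₁)) + (a * S.t₀ * S.s₀ - S.s₀ * (a * S.t₀)) := by
  rw [← corner_eq, mul_assoc a, S.t₀_s₀, mul_one, ← mul_assoc]
  abel

/-- Complementary diagonal blocks are orthogonal for every cocycle. -/
theorem orthogonal_blocks {c : A →ₗ[ℂ] A →ₗ[ℂ] ℂ} (hc : IsCommutatorCocycle c) (a b : A) :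
    c (S.s₀ * a * S.t₀) (S.s₁ * b * S.t₁) = 0 := by
  -- Opposite blocks multiply to zero, hence commute, and a cocycle vanishes on a commutator paired
  -- with an element commuting with both factors.
  have key : ∀ x y : A, c (S.s₀ * (x * y - y * x) * S.t₀) (S.s₁ * b * S.t₁) = 0 := by
    intro x y
    have h : S.s₀ * (x * y - y * x) * S.t₀ = (S.s₀ * x * S.t₀) * (S.s₀ * y * S.t₀)
        - (S.s₀ * y * S.t₀) * (S.s₀ * x * S.t₀) := by
      simp only [mul_assoc, S.t₀_s₀_mul, mul_sub, sub_mul]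
    rw [h]
    refine hc.apply_commutator_eq_zero ?_ ?_ <;>
      simp only [mul_assoc, S.t₀_s₁_mul, S.t₁_s₀_mul, mul_zero]
  rw [S.eq_add_commutator a, mul_add, add_mul, map_add, LinearMap.add_apply, key, key, add_zero]

/-- The primitive of the restriction of a cocycle to the corner `s₀ A t₀`. -/
def cornerPrimitive (c : A →ₗ[ℂ] A →ₗ[ℂ] ℂ) : A →ₗ[ℂ] ℂ :=
  c.flip S.s₁ ∘ₗ LinearMap.mulRight ℂ S.t₁ ∘ₗ S.σ

theorem cornerPrimitive_apply (c : A →ₗ[ℂ] A →ₗ[ℂ] ℂ) (a : A) :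
    S.cornerPrimitive c a = c (S.σ a * S.t₁) S.s₁ := rfl

/-- The Jacobi identity for `σ(a)`, `σ(b) t₁`, `s₁` has one zero bracket, because `σ(a)` commutes
with `s₁`. The other two brackets are `σ([a, b]) t₁` and the corner of `b`; the latter sees only the
first copy of `a` in `σ(a)`, by `orthogonal_blocks`. -/
theorem cornerPrimitive_commutator {c : A →ₗ[ℂ] A →ₗ[ℂ] ℂ} (hc : IsCommutatorCocycle c)
    (a b : A) : S.cornerPrimitive c (a * b - b * a)
      = c (S.s₀ * a * S.t₀) (S.s₀ * b * S.t₀) := by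
  have h := hc.jacobi (S.σ a) (S.σ b * S.t₁) S.s₁
  rw [← S.corner_eq, S.σ_s₁, sub_self, map_zero, LinearMap.zero_apply, add_zero] at h
  have h2 : S.σ a * (S.σ b * S.t₁) - S.σ b * S.t₁ * S.σ a = S.σ (a * b - b * a) * S.t₁ := by
    rw [mul_assoc (S.σ b), S.t₁_σ, map_sub, S.σ_mul, S.σ_mul, sub_mul, mul_assoc, mul_assoc]
  rw [h2] at h
  have h3 : c (S.s₀ * b * S.t₀) (S.σ a) = c (S.s₀ * b * S.t₀) (S.s₀ * a * S.t₀) := by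
    rw [S.σ_eq a, map_add, S.orthogonal_blocks hc, add_zero]
  rw [h3] at h
  rw [cornerPrimitive_apply, hc.skew (S.s₀ * b * S.t₀)]
  linear_combination h

/-- The primitive of a cocycle on an infinite sum ring. -/
def primitive (c : A →ₗ[ℂ] A →ₗ[ℂ] ℂ) : A →ₗ[ℂ] ℂ where
  -- Each term is forced by a bracket. With `h = s₀ t₀`, the off-diagonal blocks satisfy `[h, u] =
  -- u` and `[h, u] = -u`, which dictates `c h u` and `-c h u`. On the lower diagonal block, `[s₀ a
  -- t₁, s₁ t₀] = s₀ a t₀ - s₁ a t₁` fixes the difference from the corner value.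
  toFun x := S.cornerPrimitive c (S.t₀ * x * S.s₀) + S.cornerPrimitive c (S.t₁ * x * S.s₁)
    - c (S.s₀ * (S.t₁ * x * S.s₁) * S.t₁) (S.s₁ * S.t₀)
    + c (S.s₀ * S.t₀) (S.s₀ * (S.t₀ * x * S.s₁) * S.t₁)
    - c (S.s₀ * S.t₀) (S.s₁ * (S.t₁ * x * S.s₀) * S.t₀)
  map_add' x y := by
    simp only [mul_add, add_mul, map_add, LinearMap.add_apply]
    ring
  map_smul' r x := by
    simp only [mul_smul_comm, smul_mul_assoc, map_smul, LinearMap.smul_apply, smul_eq_mul,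
      RingHom.id_apply]
    ring

theorem primitive_apply (c : A →ₗ[ℂ] A →ₗ[ℂ] ℂ) (x : A) : S.primitive c x =
    S.cornerPrimitive c (S.t₀ * x * S.s₀) + S.cornerPrimitive c (S.t₁ * x * S.s₁)
    - c (S.s₀ * (S.t₁ * x * S.s₁) * S.t₁) (S.s₁ * S.t₀)
    + c (S.s₀ * S.t₀) (S.s₀ * (S.t₀ * x * S.s₁) * S.t₁)
    - c (S.s₀ * S.t₀) (S.s₁ * (S.t₁ * x * S.s₀) * S.t₀) := rfl

theorem block_decomposition (x : A) : x = S.s₀ * (S.t₀ * x * S.s₀) * S.t₀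
    + S.s₀ * (S.t₀ * x * S.s₁) * S.t₁ + S.s₁ * (S.t₁ * x * S.s₀) * S.t₀
    + S.s₁ * (S.t₁ * x * S.s₁) * S.t₁ := by
  calc x = (S.s₀ * S.t₀ + S.s₁ * S.t₁) * x * (S.s₀ * S.t₀ + S.s₁ * S.t₁) := by
        rw [S.s_t, one_mul, mul_one]
    _ = _ := by noncomm_ring

/-- Every two-cocycle on an infinite sum ring is a coboundary. -/
theorem eq_primitive_commutator {c : A →ₗ[ℂ] A →ₗ[ℂ] ℂ} (hc : IsCommutatorCocycle c) (x y : A) :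
    c x y = S.primitive c (x * y - y * x) := by
  set d := c - commutatorCoboundary (S.primitive c) with hd
  have hdc : IsCommutatorCocycle d := hc.sub_coboundary _
  suffices h : d x y = 0 by
    rw [hd, LinearMap.sub_apply, LinearMap.sub_apply, commutatorCoboundary_apply] at h
    exact sub_eq_zero.1 h
  have d_apply : ∀ x y, d x y = c x y - S.primitive c (x * y - y * x) := fun _ _ => rfl
  have p00 : ∀ a, S.primitive c (S.s₀ * a * S.t₀) = S.cornerPrimitive c a := fun a => by
    simp [primitive_apply, mul_assoc, S.t₀_s₀_mul, S.t₁_s₀_mul, S.t₀_s₀, S.t₀_s₁]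
  have p01 : ∀ a, S.primitive c (S.s₀ * a * S.t₁) = c (S.s₀ * S.t₀) (S.s₀ * a * S.t₁) :=
    fun a => by
    simp [primitive_apply, mul_assoc, S.t₀_s₀_mul, S.t₁_s₀_mul, S.t₁_s₁, S.t₁_s₀]
  have p10 : ∀ a, S.primitive c (S.s₁ * a * S.t₀) = -c (S.s₀ * S.t₀) (S.s₁ * a * S.t₀) :=
    fun a => by
    simp [primitive_apply, mul_assoc, S.t₁_s₁_mul, S.t₀_s₁_mul, S.t₀_s₀, S.t₀_s₁]
  have p11 : ∀ a, S.primitive c (S.s₁ * a * S.t₁) = S.cornerPrimitive c a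
      - c (S.s₀ * a * S.t₁) (S.s₁ * S.t₀) := fun a => by
    simp [primitive_apply, mul_assoc, S.t₁_s₁_mul, S.t₀_s₁_mul, S.t₁_s₁, S.t₁_s₀]
  have d0011 : ∀ a b, d (S.s₀ * a * S.t₀) (S.s₁ * b * S.t₁) = 0 := S.orthogonal_blocks hdc
  have d0000 : ∀ a b, d (S.s₀ * a * S.t₀) (S.s₀ * b * S.t₀) = 0 := fun a b => by
    have e : S.s₀ * a * S.t₀ * (S.s₀ * b * S.t₀) - S.s₀ * b * S.t₀ * (S.s₀ * a * S.t₀)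
        = S.s₀ * (a * b - b * a) * S.t₀ := by
      simp only [mul_assoc, S.t₀_s₀_mul, mul_sub, sub_mul]
    rw [d_apply, e, p00, S.cornerPrimitive_commutator hc, sub_self]
  -- the element `s₀ t₀` is orthogonal to everything
  have dh : ∀ z, d (S.s₀ * S.t₀) z = 0 := fun z => by
    have h1 : S.s₀ * S.t₀ = S.s₀ * 1 * S.t₀ := by rw [mul_one]
    rw [S.block_decomposition z, map_add, map_add, map_add]
    have h00 := d0000 1 (S.t₀ * z * S.s₀)
    have h11 := d0011 1 (S.t₁ * z * S.s₁)
    rw [← h1] at h00 h11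
    have h01 : ∀ a, d (S.s₀ * S.t₀) (S.s₀ * a * S.t₁) = 0 := fun a => by
      have e : S.s₀ * S.t₀ * (S.s₀ * a * S.t₁) - S.s₀ * a * S.t₁ * (S.s₀ * S.t₀)
          = S.s₀ * a * S.t₁ := by
        simp only [mul_assoc, S.t₀_s₀_mul, S.t₁_s₀_mul, mul_zero, sub_zero]
      rw [d_apply, e, p01, sub_self]
    have h10 : ∀ a, d (S.s₀ * S.t₀) (S.s₁ * a * S.t₀) = 0 := fun a => by
      have e : S.s₀ * S.t₀ * (S.s₁ * a * S.t₀) - S.s₁ * a * S.t₀ * (S.s₀ * S.t₀)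
          = -(S.s₁ * a * S.t₀) := by
        simp only [mul_assoc, S.t₀_s₀_mul, S.t₀_s₁_mul, mul_zero, zero_sub]
      rw [d_apply, e, map_neg, p10, neg_neg, sub_self]
    rw [h00, h11, h01, h10]
    simp
  have weight : ∀ (m n : ℂ) (u v : A), S.s₀ * S.t₀ * u - u * (S.s₀ * S.t₀) = m • u →
      S.s₀ * S.t₀ * v - v * (S.s₀ * S.t₀) = n • v → m + n ≠ 0 → d u v = 0 := by
    intro m n u v hu hv hmn
    have h := hdc.jacobi (S.s₀ * S.t₀) u v
    have hv' : v * (S.s₀ * S.t₀) - S.s₀ * S.t₀ * v = -(n • v) := by rw [← hv, neg_sub]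
    rw [hu, hv', hdc.skew (S.s₀ * S.t₀), dh, map_smul, map_neg, map_smul, LinearMap.neg_apply,
      LinearMap.smul_apply, LinearMap.smul_apply, hdc.skew u v, smul_eq_mul, smul_eq_mul] at h
    have h2 : (m + n) * d u v = 0 := by linear_combination h
    exact (mul_eq_zero.1 h2).resolve_left hmn
  have w00 : ∀ a, S.s₀ * S.t₀ * (S.s₀ * a * S.t₀) - S.s₀ * a * S.t₀ * (S.s₀ * S.t₀)
      = (0 : ℂ) • (S.s₀ * a * S.t₀) := fun a => by
    simp only [mul_assoc, S.t₀_s₀_mul, sub_self, zero_smul]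
  have w11 : ∀ a, S.s₀ * S.t₀ * (S.s₁ * a * S.t₁) - S.s₁ * a * S.t₁ * (S.s₀ * S.t₀)
      = (0 : ℂ) • (S.s₁ * a * S.t₁) := fun a => by
    simp only [mul_assoc, S.t₀_s₁_mul, S.t₁_s₀_mul, mul_zero, sub_self, zero_smul]
  have w01 : ∀ a, S.s₀ * S.t₀ * (S.s₀ * a * S.t₁) - S.s₀ * a * S.t₁ * (S.s₀ * S.t₀)
      = (1 : ℂ) • (S.s₀ * a * S.t₁) := fun a => by
    simp only [mul_assoc, S.t₀_s₀_mul, S.t₁_s₀_mul, mul_zero, sub_zero, one_smul]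
  have w10 : ∀ a, S.s₀ * S.t₀ * (S.s₁ * a * S.t₀) - S.s₁ * a * S.t₀ * (S.s₀ * S.t₀)
      = (-1 : ℂ) • (S.s₁ * a * S.t₀) := fun a => by
    simp only [mul_assoc, S.t₀_s₀_mul, S.t₀_s₁_mul, mul_zero, zero_sub, neg_smul, one_smul]
  have d0110_one : ∀ a, d (S.s₀ * a * S.t₁) (S.s₁ * S.t₀) = 0 := fun a => by
    have e : S.s₀ * a * S.t₁ * (S.s₁ * S.t₀) - S.s₁ * S.t₀ * (S.s₀ * a * S.t₁)
        = S.s₀ * a * S.t₀ - S.s₁ * a * S.t₁ := by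
      simp only [mul_assoc, S.t₀_s₀_mul, S.t₁_s₁_mul]
    rw [d_apply, e, map_sub, p00, p11]
    ring
  -- A Jacobi identity with `s₀ b t₀` moves `b` off the second argument: the remaining terms are
  -- diagonal pairings already known to vanish and the case `b = 1`.
  have d0110 : ∀ a b, d (S.s₀ * a * S.t₁) (S.s₁ * b * S.t₀) = 0 := fun a b => by
    have h := hdc.jacobi (S.s₀ * b * S.t₀) (S.s₀ * a * S.t₁) (S.s₁ * S.t₀)
    have e1 : S.s₀ * b * S.t₀ * (S.s₀ * a * S.t₁) - S.s₀ * a * S.t₁ * (S.s₀ * b * S.t₀)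
        = S.s₀ * (b * a) * S.t₁ := by
      simp only [mul_assoc, S.t₀_s₀_mul, S.t₁_s₀_mul, mul_zero, sub_zero]
    have e2 : S.s₀ * a * S.t₁ * (S.s₁ * S.t₀) - S.s₁ * S.t₀ * (S.s₀ * a * S.t₁)
        = S.s₀ * a * S.t₀ - S.s₁ * a * S.t₁ := by
      simp only [mul_assoc, S.t₀_s₀_mul, S.t₁_s₁_mul]
    have e3 : S.s₁ * S.t₀ * (S.s₀ * b * S.t₀) - S.s₀ * b * S.t₀ * (S.s₁ * S.t₀)
        = S.s₁ * b * S.t₀ := by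
      simp only [mul_assoc, S.t₀_s₀_mul, S.t₀_s₁_mul, mul_zero, sub_zero]
    rw [e1, e2, e3, d0110_one, map_sub, LinearMap.sub_apply, d0000,
      hdc.skew (S.s₀ * b * S.t₀) (S.s₁ * a * S.t₁), d0011, hdc.skew (S.s₀ * a * S.t₁)] at h
    simpa using h
  -- The bracket of `s₀ a t₁` and `s₁ t₀` trades the lower diagonal block for the upper one, which
  -- is orthogonal to `s₁ b t₁`; the other two terms pair opposite off-diagonal blocks.
  have d1111 : ∀ a b, d (S.s₁ * a * S.t₁) (S.s₁ * b * S.t₁) = 0 := fun a b => by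
    have h := hdc.jacobi (S.s₀ * a * S.t₁) (S.s₁ * S.t₀) (S.s₁ * b * S.t₁)
    have e1 : S.s₀ * a * S.t₁ * (S.s₁ * S.t₀) - S.s₁ * S.t₀ * (S.s₀ * a * S.t₁)
        = S.s₀ * a * S.t₀ - S.s₁ * a * S.t₁ := by
      simp only [mul_assoc, S.t₀_s₀_mul, S.t₁_s₁_mul]
    have e2 : S.s₁ * S.t₀ * (S.s₁ * b * S.t₁) - S.s₁ * b * S.t₁ * (S.s₁ * S.t₀)
        = -(S.s₁ * b * S.t₀) := by
      simp only [mul_assoc, S.t₁_s₁_mul, S.t₀_s₁_mul, mul_zero, zero_sub]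
    have e3 : S.s₁ * b * S.t₁ * (S.s₀ * a * S.t₁) - S.s₀ * a * S.t₁ * (S.s₁ * b * S.t₁)
        = -(S.s₀ * (a * b) * S.t₁) := by
      simp only [mul_assoc, S.t₁_s₁_mul, S.t₁_s₀_mul, mul_zero, zero_sub]
    rw [e1, e2, e3, map_sub, LinearMap.sub_apply, d0011, map_neg, LinearMap.neg_apply,
      map_neg, LinearMap.neg_apply, d0110_one, hdc.skew (S.s₀ * a * S.t₁), d0110] at h
    simpa using h
  have flip0 : ∀ u v, d u v = 0 → d v u = 0 := fun u v h => by rw [hdc.skew u v, h, neg_zero]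
  rw [S.block_decomposition x, S.block_decomposition y]
  simp only [map_add, LinearMap.add_apply]
  rw [d0000, d0011, d0110, d1111, flip0 _ _ (d0011 _ _), flip0 _ _ (d0110 _ _),
    weight _ _ _ _ (w00 _) (w01 _), weight _ _ _ _ (w00 _) (w10 _),
    weight _ _ _ _ (w01 _) (w00 _), weight _ _ _ _ (w10 _) (w00 _),
    weight _ _ _ _ (w01 _) (w01 _), weight _ _ _ _ (w10 _) (w10 _),
    weight _ _ _ _ (w11 _) (w01 _), weight _ _ _ _ (w11 _) (w10 _),
    weight _ _ _ _ (w01 _) (w11 _), weight _ _ _ _ (w10 _) (w11 _)]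
  all_goals norm_num

end InfiniteSum

end InfiniteSum

end Metaplectic

namespace Metaplectic
noncomputable section

/-! ### Endomorphisms of a space of countable dimension -/

/-- The space of finitely supported sequences. -/
abbrev FinSeq : Type := ℕ →₀ ℂ

/-- The standard basis of `FinSeq`. -/
abbrev seqBasis (n : ℕ) : FinSeq := Finsupp.single n 1

/-- The linear map with prescribed values on the standard basis. -/
abbrev ofValues {W : Type*} [AddCommGroup W] [Module ℂ W] (F : ℕ → W) : FinSeq →ₗ[ℂ] W :=
  Finsupp.linearCombination ℂ F

theorem ofValues_seqBasis {W : Type*} [AddCommGroup W] [Module ℂ W] (F : ℕ → W) (n : ℕ) :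
    ofValues F (seqBasis n) = F n := by simp

theorem finSeq_hom_ext {W : Type*} [AddCommGroup W] [Module ℂ W] {f g : FinSeq →ₗ[ℂ] W}
    (h : ∀ n, f (seqBasis n) = g (seqBasis n)) : f = g :=
  Finsupp.lhom_ext' fun n => LinearMap.ext_ring (h n)

/-- Values on the basis of the endomorphism which acts as `x` on each of the blocks
`{2 ^ k (2 n + 1) - 1 | n}`. -/
def sigmaValues (x : Module.End ℂ FinSeq) (n : ℕ) : FinSeq :=
  if h : n % 2 = 0 then ofValues (fun k => seqBasis (2 * k)) (x (seqBasis (n / 2)))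
  else ofValues (fun k => seqBasis (2 * k + 1)) (sigmaValues x (n / 2))
termination_by n
decreasing_by omega

theorem sigmaValues_even (x : Module.End ℂ FinSeq) (n : ℕ) : sigmaValues x (2 * n)
    = ofValues (fun k => seqBasis (2 * k)) (x (seqBasis n)) := by
  rw [sigmaValues, dif_pos (by omega), Nat.mul_div_cancel_left n two_pos]

theorem sigmaValues_odd (x : Module.End ℂ FinSeq) (n : ℕ) : sigmaValues x (2 * n + 1)
    = ofValues (fun k => seqBasis (2 * k + 1)) (sigmaValues x n) := by
  rw [sigmaValues, dif_neg (by omega), show (2 * n + 1) / 2 = n by omega]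

theorem nat_binary_induction {P : ℕ → Prop} (h0 : ∀ n, P (2 * n))
    (h1 : ∀ n, P n → P (2 * n + 1)) (n : ℕ) : P n := by
  induction n using Nat.strong_induction_on with
  | _ n ih =>
    obtain ⟨k, rfl | rfl⟩ := Nat.even_or_odd' n
    · exact h0 k
    · exact h1 k (ih k (by omega))

theorem sigmaValues_add (x y : Module.End ℂ FinSeq) (n : ℕ) :
    sigmaValues (x + y) n = sigmaValues x n + sigmaValues y n := by
  induction n using nat_binary_induction with
  | h0 n => simp only [sigmaValues_even, LinearMap.add_apply, map_add]
  | h1 n ih => simp only [sigmaValues_odd, ih, map_add]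

theorem sigmaValues_smul (r : ℂ) (x : Module.End ℂ FinSeq) (n : ℕ) :
    sigmaValues (r • x) n = r • sigmaValues x n := by
  induction n using nat_binary_induction with
  | h0 n => simp only [sigmaValues_even, LinearMap.smul_apply, map_smul]
  | h1 n ih => simp only [sigmaValues_odd, ih, map_smul]

/-- `End (FinSeq)` is an infinite sum ring. -/
def endInfiniteSum : InfiniteSum (Module.End ℂ FinSeq) :=
  let s₀ : Module.End ℂ FinSeq := ofValues fun k => seqBasis (2 * k)
  let s₁ : Module.End ℂ FinSeq := ofValues fun k => seqBasis (2 * k + 1)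
  let t₀ : Module.End ℂ FinSeq := ofValues fun k => if k % 2 = 0 then seqBasis (k / 2) else 0
  let t₁ : Module.End ℂ FinSeq := ofValues fun k => if k % 2 = 0 then 0 else seqBasis (k / 2)
  let σ : Module.End ℂ FinSeq →ₗ[ℂ] Module.End ℂ FinSeq :=
    { toFun := fun x => ofValues (sigmaValues x)
      map_add' := fun x y => finSeq_hom_ext fun n => by
        rw [LinearMap.add_apply, ofValues_seqBasis, ofValues_seqBasis, ofValues_seqBasis,
          sigmaValues_add]
      map_smul' := fun r x => finSeq_hom_ext fun n => by
        rw [LinearMap.smul_apply, ofValues_seqBasis, ofValues_seqBasis, sigmaValues_smul]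
        rfl }
  have a0 : ∀ n, s₀ (seqBasis n) = seqBasis (2 * n) := fun n => ofValues_seqBasis _ n
  have a1 : ∀ n, s₁ (seqBasis n) = seqBasis (2 * n + 1) := fun n => ofValues_seqBasis _ n
  have b00 : ∀ n, t₀ (seqBasis (2 * n)) = seqBasis n := fun n => by
    refine (ofValues_seqBasis _ _).trans ?_
    rw [if_pos (by omega), Nat.mul_div_cancel_left n two_pos]
  have b01 : ∀ n, t₀ (seqBasis (2 * n + 1)) = 0 := fun n => by
    refine (ofValues_seqBasis _ _).trans ?_
    rw [if_neg (by omega)]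
  have b10 : ∀ n, t₁ (seqBasis (2 * n)) = 0 := fun n => by
    refine (ofValues_seqBasis _ _).trans ?_
    rw [if_pos (by omega)]
  have b11 : ∀ n, t₁ (seqBasis (2 * n + 1)) = seqBasis n := fun n => by
    refine (ofValues_seqBasis _ _).trans ?_
    rw [if_neg (by omega), show (2 * n + 1) / 2 = n by omega]
  have c0 : ∀ x n, σ x (seqBasis (2 * n)) = s₀ (x (seqBasis n)) := fun x n =>
    (ofValues_seqBasis _ _).trans (sigmaValues_even x n)
  have c1 : ∀ x n, σ x (seqBasis (2 * n + 1)) = s₁ (σ x (seqBasis n)) := fun x n =>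
    (ofValues_seqBasis _ _).trans ((sigmaValues_odd x n).trans
      (congrArg s₁ (ofValues_seqBasis (sigmaValues x) n).symm))
  -- Even indices carry one copy of `x`, and odd indices carry a copy of `σ x` itself. Halving an
  -- odd index strictly decreases it, so multiplicativity of `σ` follows by binary induction.
  have σ_s₀ : ∀ x v, σ x (s₀ v) = s₀ (x v) := fun x v =>
    LinearMap.congr_fun (f := σ x * s₀) (g := s₀ * x)
      (finSeq_hom_ext fun n => by
        rw [Module.End.mul_apply, Module.End.mul_apply, a0, c0]) v
  have σ_s₁ : ∀ x v, σ x (s₁ v) = s₁ (σ x v) := fun x v =>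
    LinearMap.congr_fun (f := σ x * s₁) (g := s₁ * σ x)
      (finSeq_hom_ext fun n => by
        rw [Module.End.mul_apply, Module.End.mul_apply, a1, c1]) v
  { s₀ := s₀
    s₁ := s₁
    t₀ := t₀
    t₁ := t₁
    σ := σ
    t₀_s₀ := finSeq_hom_ext fun n => by rw [Module.End.mul_apply, a0, b00, Module.End.one_apply]
    t₁_s₁ := finSeq_hom_ext fun n => by rw [Module.End.mul_apply, a1, b11, Module.End.one_apply]
    t₀_s₁ := finSeq_hom_ext fun n => by rw [Module.End.mul_apply, a1, b01, LinearMap.zero_apply]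
    t₁_s₀ := finSeq_hom_ext fun n => by rw [Module.End.mul_apply, a0, b10, LinearMap.zero_apply]
    s_t := finSeq_hom_ext fun n => by
      rw [LinearMap.add_apply, Module.End.mul_apply, Module.End.mul_apply, Module.End.one_apply]
      obtain ⟨k, rfl | rfl⟩ := Nat.even_or_odd' n
      · rw [b00, b10, a0, map_zero, add_zero]
      · rw [b01, b11, a1, map_zero, zero_add]
    σ_mul := fun x y => finSeq_hom_ext fun n => by
      rw [Module.End.mul_apply]
      induction n using nat_binary_induction with
      | h0 n => rw [c0, c0, σ_s₀, Module.End.mul_apply]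
      | h1 n ih => rw [c1, c1, σ_s₁, ih]
    σ_eq := fun x => finSeq_hom_ext fun n => by
      simp only [LinearMap.add_apply, Module.End.mul_apply]
      obtain ⟨k, rfl | rfl⟩ := Nat.even_or_odd' n
      · rw [b00, b10, c0, map_zero, map_zero, add_zero]
      · rw [b01, b11, c1, map_zero, map_zero, zero_add] }

/-- The endomorphisms killing the first `N` basis vectors; these form a basis of neighbourhoods of
`0` for pointwise convergence. -/
def annihilators (N : ℕ) : Set (Module.End ℂ FinSeq) := {a | ∀ n < N, a (seqBasis n) = 0}

theorem annihilators_anti {M N : ℕ} (h : M ≤ N) : annihilators N ⊆ annihilators M :=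
  fun _ ha n hn => ha n (hn.trans_le h)

theorem exists_annihilators_apply (v : FinSeq) : ∃ N, ∀ a ∈ annihilators N, a v = 0 := by
  induction v using Finsupp.induction_linear with
  | zero => exact ⟨0, fun a _ => map_zero a⟩
  | add v w hv hw =>
    obtain ⟨M, hM⟩ := hv
    obtain ⟨N, hN⟩ := hw
    refine ⟨max M N, fun a ha => ?_⟩
    rw [map_add, hM a (annihilators_anti (le_max_left _ _) ha),
      hN a (annihilators_anti (le_max_right _ _) ha), add_zero]
  | single n r =>
    refine ⟨n + 1, fun a ha => ?_⟩
    rw [← mul_one r, ← smul_eq_mul, ← Finsupp.smul_single, map_smul, ha n n.lt_succ_self,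
      smul_zero]

/-- Continuity at `0`, for pointwise convergence, of a map between endomorphisms. -/
theorem exists_annihilators_map {L : Module.End ℂ FinSeq → Module.End ℂ FinSeq}
    (hL : ∀ v, ∃ N, ∀ a ∈ annihilators N, L a v = 0) (M : ℕ) :
    ∃ N, ∀ a ∈ annihilators N, L a ∈ annihilators M := by
  choose f hf using hL
  refine ⟨(Finset.range M).sup fun n => f (seqBasis n), fun a ha n hn => hf _ a ?_⟩
  exact annihilators_anti
    (Finset.le_sup (f := fun n => f (seqBasis n)) (Finset.mem_range.2 hn)) ha

/-- `q v` has finite support, so `p a q v` depends on finitely many values of `a`. -/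
theorem exists_annihilators_mul_mul (p q : Module.End ℂ FinSeq) (M : ℕ) :
    ∃ N, ∀ a ∈ annihilators N, p * a * q ∈ annihilators M :=
  exists_annihilators_map (fun v => by
    obtain ⟨N, hN⟩ := exists_annihilators_apply (q v)
    exact ⟨N, fun a ha => by
      rw [Module.End.mul_apply, Module.End.mul_apply, hN a ha, map_zero]⟩) M

/-- `σ(a)` at a basis vector is the image of `a` at a single basis vector, reached by removing
trailing odd digits. The swindle is therefore continuous for pointwise convergence, which is what
makes the primitive continuous. -/
theorem exists_annihilators_sigma (M : ℕ) :
    ∃ N, ∀ a ∈ annihilators N, endInfiniteSum.σ a ∈ annihilators M := by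
  have h : ∀ n, ∃ N, ∀ a ∈ annihilators N, sigmaValues a n = 0 := fun n => by
    induction n using nat_binary_induction with
    | h0 n => exact ⟨n + 1, fun a ha => by rw [sigmaValues_even, ha n n.lt_succ_self, map_zero]⟩
    | h1 n ih =>
      obtain ⟨N, hN⟩ := ih
      exact ⟨N, fun a ha => by rw [sigmaValues_odd, hN a ha, map_zero]⟩
  choose f hf using h
  refine ⟨(Finset.range M).sup f, fun a ha n hn => ?_⟩
  refine (ofValues_seqBasis (sigmaValues a) n).trans (hf n a ?_)
  exact annihilators_anti (Finset.le_sup (Finset.mem_range.2 hn)) ha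

/-- The primitive of a separately continuous cocycle is continuous. -/
theorem exists_annihilators_primitive {c : Module.End ℂ FinSeq →ₗ[ℂ] Module.End ℂ FinSeq →ₗ[ℂ] ℂ}
    (hc : IsCommutatorCocycle (A := Module.End ℂ FinSeq) c)
    (h : ∀ y, ∃ N, ∀ a ∈ annihilators N, c a y = 0) :
    ∃ N, ∀ a ∈ annihilators N, endInfiniteSum.primitive c a = 0 := by
  set S := endInfiniteSum
  have comp : ∀ p q y, ∃ N, ∀ a ∈ annihilators N, c (p * a * q) y = 0 := fun p q y => by
    obtain ⟨M, hM⟩ := h y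
    obtain ⟨N, hN⟩ := exists_annihilators_mul_mul p q M
    exact ⟨N, fun a ha => hM _ (hN a ha)⟩
  have corner : ∀ p q, ∃ N, ∀ a ∈ annihilators N, S.cornerPrimitive c (p * a * q) = 0 :=
    fun p q => by
    obtain ⟨N₁, h₁⟩ := comp 1 S.t₁ S.s₁
    obtain ⟨N₂, h₂⟩ := exists_annihilators_sigma N₁
    obtain ⟨N₃, h₃⟩ := exists_annihilators_mul_mul p q N₂
    refine ⟨N₃, fun a ha => ?_⟩
    have := h₁ _ (h₂ _ (h₃ a ha))
    rwa [one_mul] at this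
  obtain ⟨N₁, h₁⟩ := corner S.t₀ S.s₀
  obtain ⟨N₂, h₂⟩ := corner S.t₁ S.s₁
  obtain ⟨N₃, h₃⟩ := comp (S.s₀ * S.t₁) (S.s₁ * S.t₁) (S.s₁ * S.t₀)
  obtain ⟨N₄, h₄⟩ := comp (S.s₀ * S.t₀) (S.s₁ * S.t₁) (S.s₀ * S.t₀)
  obtain ⟨N₅, h₅⟩ := comp (S.s₁ * S.t₁) (S.s₀ * S.t₀) (S.s₀ * S.t₀)
  refine ⟨max N₁ (max N₂ (max N₃ (max N₄ N₅))), fun a ha => ?_⟩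
  -- The last two terms of the primitive have the variable in the second slot; skew-symmetry moves
  -- it to the first, where continuity is assumed.
  rw [S.primitive_apply, h₁ a (annihilators_anti (by simp) ha),
    h₂ a (annihilators_anti (by simp) ha), hc.skew _ (S.s₀ * S.t₀), hc.skew _ (S.s₀ * S.t₀)]
  have e₃ := h₃ a (annihilators_anti (by simp) ha)
  have e₄ := h₄ a (annihilators_anti (by simp) ha)
  have e₅ := h₅ a (annihilators_anti (by simp) ha)
  simp only [mul_assoc] at e₃ e₄ e₅ ⊢
  rw [e₃, e₄, e₅]
  simp

/-! ### The pairing of `H' / H'_+` with `H'_+` -/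

theorem finite_negCoeffs (f : HPrime) :
    (Function.support fun n : ℕ => f.val.coeff (-(n : ℤ) - 1)).Finite := by
  obtain ⟨N, hN⟩ := exists_mem_lattice f
  refine (Set.finite_lt_nat (-N).toNat).subset fun n hn => ?_
  by_contra h
  exact hn (hN _ (by simp only [Set.mem_ofPred_eq, not_lt] at h; omega))

/-- The coefficients of `t⁻¹, t⁻², …`; the kernel is `H'_+`. -/
def negCoeffs : HPrime →ₗ[ℂ] FinSeq where
  toFun f := Finsupp.ofSupportFinite _ (finite_negCoeffs f)
  map_add' f g := by ext n; simp [Finsupp.ofSupportFinite_coe]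
  map_smul' c f := by ext n; simp [Finsupp.ofSupportFinite_coe]

theorem negCoeffs_apply (f : HPrime) (n : ℕ) : negCoeffs f n = f.val.coeff (-(n : ℤ) - 1) := rfl

theorem negCoeffs_eq_zero_iff {f : HPrime} : negCoeffs f = 0 ↔ f ∈ HPlus := by
  rw [Finsupp.ext_iff]
  constructor
  · intro h n hn
    rcases lt_or_eq_of_le (show n ≤ 0 by omega) with h0 | rfl
    · have := h (-n - 1).toNat
      rw [negCoeffs_apply] at this
      rwa [show -((-n - 1).toNat : ℤ) - 1 = n by omega] at this
    · exact coeff_zero_eq f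
  · intro h n
    exact h _ (by omega)

theorem symp_eq_zero_of_mem_HPlus {f g : HPrime} (hf : f ∈ HPlus) (hg : g ∈ HPlus) :
    symp f g = 0 := by
  rw [symp_eq_sum (M := 0) (lattice_anti (by simp) hf) (lattice_anti (by simp) hg)]
  simp

theorem coeff_b_self {k : ℤ} (hk : k ≠ 0) : (b k).val.coeff k = 1 := by
  rw [coeff_b, if_pos ⟨rfl, hk⟩]

theorem symp_b (k : ℤ) (g : HPrime) : symp (b k) g = k * g.val.coeff (-k) := by
  obtain ⟨m, hm⟩ := exists_mem_lattice g
  set M := max (-m) |k|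
  have hk : |k| ≤ M := le_max_right _ _
  have hk2 := abs_le.1 hk
  rw [symp_eq_sum (M := M) (lattice_anti (by omega) (b_mem k))
    (lattice_anti (by have := le_max_left (-m) |k|; omega) hm), Finset.sum_eq_single k]
  · by_cases h : k = 0
    · simp [h]
    · rw [coeff_b_self h, mul_one]
  · intro n _ hn
    rw [coeff_b, if_neg (fun h => hn h.1), mul_zero, zero_mul]
  · intro h
    exact absurd (Finset.mem_Icc.2 hk2) h

/-- The form pairs the coefficient of `t ^ n` with that of `t ^ (-n)`, so a pole of order at most
`N` does not meet `t ^ (N + 1) ℂ⟦t⟧`. -/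
theorem symp_eq_zero_of_mem_lattice {N : ℕ} {f g : HPrime} (hf : f ∈ lattice (-(N : ℤ)))
    (hg : g ∈ lattice ((N : ℤ) + 1)) : symp f g = 0 := by
  rw [symp_eq_sum (M := N) hf (lattice_anti (by omega) hg)]
  refine Finset.sum_eq_zero fun n hn => ?_
  rw [Finset.mem_Icc] at hn
  rw [hg (-n) (by omega), mul_zero]

theorem exists_symp_eq_zero (f : HPrime) : ∃ N : ℕ, ∀ g ∈ lattice N, symp f g = 0 := by
  obtain ⟨m, hm⟩ := exists_mem_lattice f
  refine ⟨(-m).toNat + 1, fun g hg =>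
    symp_eq_zero_of_mem_lattice (N := (-m).toNat) (lattice_anti (by omega) hm) ?_⟩
  push_cast at hg
  exact hg

/-- The element of `H'_+` which represents a linear form on `H' / H'_+`. -/
def represent : (FinSeq →ₗ[ℂ] ℂ) →ₗ[ℂ] HPrime where
  toFun φ := ⟨HahnSeries.ofSuppBddBelow
      -- The pairing of `t ^ (-n)` with `g` is `-n` times the coefficient of `t ^ n` in `g`, and
      -- basis vector number `n - 1` of `FinSeq` stands for `t ^ (-n)`.
      (fun n : ℤ => if 0 < n then -φ (seqBasis (n - 1).toNat) / n else 0)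
      ⟨0, fun n hn => by
        by_contra h
        exact hn (if_neg (by omega))⟩, by
    change (if (0 : ℤ) < 0 then -φ (seqBasis ((0 : ℤ) - 1).toNat) / ((0 : ℤ) : ℂ) else 0) = 0
    rw [if_neg (lt_irrefl _)]⟩
  map_add' φ χ := HPrime.ext fun n => by
    change (if 0 < n then _ else (0 : ℂ)) = (if 0 < n then _ else 0) + (if 0 < n then _ else 0)
    split_ifs
    · rw [LinearMap.add_apply]; ring
    · simp
  map_smul' c φ := HPrime.ext fun n => by
    change (if 0 < n then _ else (0 : ℂ)) = c * (if 0 < n then _ else 0)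
    split_ifs
    · rw [LinearMap.smul_apply, smul_eq_mul]; ring
    · simp

theorem coeff_represent (φ : FinSeq →ₗ[ℂ] ℂ) (n : ℤ) : (represent φ).val.coeff n
    = if 0 < n then -φ (seqBasis (n - 1).toNat) / n else 0 := rfl

theorem represent_mem (φ : FinSeq →ₗ[ℂ] ℂ) : represent φ ∈ HPlus := fun n hn => by
  rw [coeff_represent, if_neg (by omega)]

theorem negCoeffs_b (n : ℕ) : negCoeffs (b (-(n : ℤ) - 1)) = seqBasis n := by
  ext k
  rw [negCoeffs_apply, coeff_b, Finsupp.single_apply]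
  congr 1
  exact propext ⟨fun h => by omega, fun h => ⟨by omega, by omega⟩⟩

theorem symp_b_represent (φ : FinSeq →ₗ[ℂ] ℂ) (n : ℕ) :
    symp (b (-(n : ℤ) - 1)) (represent φ) = φ (seqBasis n) := by
  rw [symp_b, coeff_represent, if_pos (by omega),
    show (-(-(n : ℤ) - 1) - 1).toNat = n by omega]
  push_cast
  have h : (n : ℂ) + 1 ≠ 0 := by exact_mod_cast n.succ_ne_zero
  rw [show -(-(n : ℂ) - 1) = n + 1 by ring, show -(n : ℂ) - 1 = -(n + 1) by ring]
  field_simp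

/-- A section of `negCoeffs`, with image `H_-`. -/
def negSection : FinSeq →ₗ[ℂ] HPrime := ofValues fun n : ℕ => b (-(n : ℤ) - 1)

theorem negCoeffs_negSection (v : FinSeq) : negCoeffs (negSection v) = v :=
  LinearMap.congr_fun (f := negCoeffs ∘ₗ negSection) (g := LinearMap.id)
    (finSeq_hom_ext fun n => by
      rw [LinearMap.comp_apply, negSection, ofValues_seqBasis, negCoeffs_b, LinearMap.id_apply]) v

/-- Since `H'_+` is isotropic, pairing with `represent φ` depends only on the class modulo `H'_+`;
this reduces the claim to powers of `t⁻¹`. -/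
theorem symp_represent (φ : FinSeq →ₗ[ℂ] ℂ) (f : HPrime) :
    symp f (represent φ) = φ (negCoeffs f) := by
  have h : symp.flip (represent φ) ∘ₗ negSection = φ := finSeq_hom_ext fun n => by
    rw [LinearMap.comp_apply, negSection, ofValues_seqBasis]
    exact symp_b_represent φ n
  have h2 : f - negSection (negCoeffs f) ∈ HPlus := by
    rw [← negCoeffs_eq_zero_iff, map_sub, negCoeffs_negSection, sub_self]
  have h3 := symp_eq_zero_of_mem_HPlus h2 (represent_mem φ)
  rw [map_sub, LinearMap.sub_apply, sub_eq_zero] at h3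
  rw [h3]
  exact LinearMap.congr_fun h _

/-! ### Lagrangian complements of `H'_+` -/

theorem mem_perp_iff {F : Submodule ℂ HPrime} {f : HPrime} :
    f ∈ perp F ↔ ∀ z ∈ F, symp z f = 0 := Iff.rfl

theorem IsLagrangian.symp_eq_zero {Z : Submodule ℂ HPrime} (hZ : IsLagrangian Z) {f g : HPrime}
    (hf : f ∈ Z) (hg : g ∈ Z) : symp f g = 0 := by
  rw [← show perp Z = Z from hZ, mem_perp_iff] at hg
  exact hg f hf

theorem IsLagrangian.mem_of_symp_eq_zero {Z : Submodule ℂ HPrime} (hZ : IsLagrangian Z)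
    {f : HPrime} (h : ∀ z ∈ Z, symp z f = 0) : f ∈ Z := by
  rw [← show perp Z = Z from hZ, mem_perp_iff]
  exact h

/-- Injectivity is `Z ∩ H'_+ = 0`. If the image were proper, a nonzero linear form would vanish on
it; its representative lies in `H'_+` and is orthogonal to `Z`, hence lies in `Z` by maximality and
is zero. -/
theorem exists_linearEquiv_of_isLagrangian {Z : Submodule ℂ HPrime} (hZ : IsLagrangian Z)
    (hZP : Z ⊓ HPlus = ⊥) : ∃ e : Z ≃ₗ[ℂ] FinSeq, ∀ z : Z, e z = negCoeffs z := by
  refine ⟨LinearEquiv.ofBijective (negCoeffs ∘ₗ Z.subtype) ⟨?_, ?_⟩, fun z => rfl⟩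
  · rw [← LinearMap.ker_eq_bot, LinearMap.ker_eq_bot']
    intro z hz
    have h : (z : HPrime) ∈ Z ⊓ HPlus := ⟨z.2, negCoeffs_eq_zero_iff.1 hz⟩
    rw [hZP, Submodule.mem_bot] at h
    exact Subtype.ext h
  · rw [← LinearMap.range_eq_top]
    by_contra hne
    obtain ⟨φ, hφ, hle⟩ := Submodule.exists_le_ker_of_lt_top _ (lt_top_iff_ne_top.2 hne)
    apply hφ
    have h : represent φ ∈ Z ⊓ HPlus := by
      refine ⟨hZ.mem_of_symp_eq_zero fun z hz => ?_, represent_mem φ⟩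
      rw [symp_represent]
      exact hle ⟨⟨z, hz⟩, rfl⟩
    rw [hZP, Submodule.mem_bot] at h
    refine finSeq_hom_ext fun n => ?_
    rw [← symp_b_represent, h, map_zero, LinearMap.zero_apply]

/-- A Lagrangian complement of `H'_+`, parametrized by `FinSeq`. -/
structure LagrangianFrame (Z : Submodule ℂ HPrime) where
  ι : FinSeq →ₗ[ℂ] HPrime
  mem : ∀ v, ι v ∈ Z
  negCoeffs_ι : ∀ v, negCoeffs (ι v) = v
  ι_negCoeffs : ∀ z ∈ Z, ι (negCoeffs z) = z
  lagrangian : IsLagrangian Z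

theorem nonempty_lagrangianFrame {Z : Submodule ℂ HPrime} (hZ : IsLagrangian Z)
    (hZP : Z ⊓ HPlus = ⊥) : Nonempty (LagrangianFrame Z) := by
  obtain ⟨e, he⟩ := exists_linearEquiv_of_isLagrangian hZ hZP
  exact ⟨{
    ι := Z.subtype ∘ₗ e.symm.toLinearMap
    mem := fun v => (e.symm v).2
    negCoeffs_ι := fun v => (he _).symm.trans (e.apply_symm_apply v)
    ι_negCoeffs := fun z hz => by
      have := e.symm_apply_apply ⟨z, hz⟩
      rw [he] at this
      exact congrArg Subtype.val this
    lagrangian := hZ }⟩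

/-! ### The lift of `gl(Z)` to endomorphisms of `H'` -/

namespace LagrangianFrame

variable {Z : Submodule ℂ HPrime} (Φ : LagrangianFrame Z)

theorem eq_zero_of_mem (Φ : LagrangianFrame Z) {f : HPrime} (hf : f ∈ Z) (hf' : f ∈ HPlus) :
    f = 0 := by
  rw [← Φ.ι_negCoeffs f hf, negCoeffs_eq_zero_iff.2 hf', map_zero]

theorem sub_mem_HPlus (f : HPrime) : f - Φ.ι (negCoeffs f) ∈ HPlus := by
  rw [← negCoeffs_eq_zero_iff, map_sub, Φ.negCoeffs_ι, sub_self]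

/-- The adjoint of an endomorphism of `Z`, composed with a projection to `H'_+`. -/
def adjoint : Module.End ℂ FinSeq →ₗ[ℂ] Module.End ℂ HPrime :=
  LinearMap.mk₂ ℂ (fun a f => represent (symp.flip f ∘ₗ Φ.ι ∘ₗ a))
    (fun a a' f => by rw [← map_add]; congr 1; ext v; simp)
    (fun r a f => by rw [← map_smul]; congr 1; ext v; simp)
    (fun a f g => by rw [← map_add]; congr 1; ext v; simp)
    (fun r a f => by rw [← map_smul]; congr 1; ext v; simp)

theorem adjoint_mem (a : Module.End ℂ FinSeq) (f : HPrime) : Φ.adjoint a f ∈ HPlus :=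
  represent_mem _

theorem symp_adjoint (a : Module.End ℂ FinSeq) (f g : HPrime) :
    symp g (Φ.adjoint a f) = symp (Φ.ι (a (negCoeffs g))) f := symp_represent _ _

theorem coeff_adjoint (a : Module.End ℂ FinSeq) (f : HPrime) (n : ℤ) :
    (Φ.adjoint a f).val.coeff n
      = if 0 < n then -symp (Φ.ι (a (seqBasis (n - 1).toNat))) f / n else 0 := rfl

/-- The extension of an endomorphism of `Z` to `H'` by minus its adjoint on `H'_+`. -/
def liftEnd : Module.End ℂ FinSeq →ₗ[ℂ] Module.End ℂ HPrime where
  toFun a := Φ.ι ∘ₗ a ∘ₗ negCoeffs - Φ.adjoint a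
  map_add' a a' := by
    rw [map_add, LinearMap.add_comp, LinearMap.comp_add]; abel
  map_smul' r a := by
    rw [map_smul, LinearMap.smul_comp, LinearMap.comp_smul, RingHom.id_apply, smul_sub]

theorem liftEnd_apply (a : Module.End ℂ FinSeq) (f : HPrime) :
    Φ.liftEnd a f = Φ.ι (a (negCoeffs f)) - Φ.adjoint a f := rfl

theorem adjoint_of_mem (a : Module.End ℂ FinSeq) {z : HPrime} (hz : z ∈ Z) :
    Φ.adjoint a z = 0 := HPrime.ext fun n => by
  rw [coeff_adjoint, Φ.lagrangian.symp_eq_zero (Φ.mem _) hz]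
  simp

theorem liftEnd_of_mem (a : Module.End ℂ FinSeq) {z : HPrime} (hz : z ∈ Z) :
    Φ.liftEnd a z = Φ.ι (a (negCoeffs z)) := by
  rw [liftEnd_apply, Φ.adjoint_of_mem a hz, sub_zero]

theorem liftEnd_of_mem_HPlus (a : Module.End ℂ FinSeq) {f : HPrime} (hf : f ∈ HPlus) :
    Φ.liftEnd a f ∈ HPlus := by
  rw [liftEnd_apply, negCoeffs_eq_zero_iff.2 hf, map_zero, map_zero, zero_sub]
  exact HPlus.neg_mem (Φ.adjoint_mem a f)

/-- By the adjunction `symp_adjoint` and skew-symmetry, the two adjoint terms cancel the two terms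
coming from `a` crosswise. -/
theorem symp_liftEnd (a : Module.End ℂ FinSeq) (f g : HPrime) :
    symp (Φ.liftEnd a f) g + symp f (Φ.liftEnd a g) = 0 := by
  rw [liftEnd_apply, liftEnd_apply, map_sub, LinearMap.sub_apply, map_sub, Φ.symp_adjoint,
    symp_skew g (Φ.adjoint a f), Φ.symp_adjoint, symp_skew (Φ.ι (a (negCoeffs g))) f]
  ring

end LagrangianFrame
-- Continuity of the lift, and the embedding of `gl(Z)` into `sp(H')`
theorem IsCts.continuous {X : Module.End ℂ HPrime} (hX : IsCts X) : Continuous X := by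
  refine continuous_of_continuousAt_zero X ?_
  rw [ContinuousAt, map_zero]
  refine (nhds_zero_basis.tendsto_iff nhds_zero_basis).2 fun m _ => ?_
  obtain ⟨n, hn⟩ := hX m
  exact ⟨n, trivial, hn⟩

theorem nhds_zero_sp : (𝓝 (0 : sp)).HasBasis (fun _ : ℕ => True) spNhd := by
  have h := spBasis.nhds_zero_hasBasis
  refine h.to_hasBasis ?_ fun n _ => ⟨spNhd n, ⟨n, rfl⟩, subset_rfl⟩
  rintro _ ⟨n, rfl⟩
  exact ⟨n, trivial, subset_rfl⟩

instance : IsTopologicalAddGroup sp := spBasis.isTopologicalAddGroup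

theorem apply_eq_zero_of_mem_annihilators {N : ℕ} {a : Module.End ℂ FinSeq}
    (ha : a ∈ annihilators N) {v : FinSeq} (hv : ∀ n, N ≤ n → v n = 0) : a v = 0 := by
  have h : a = ofValues fun n => a (seqBasis n) := finSeq_hom_ext fun n =>
    (ofValues_seqBasis (fun n => a (seqBasis n)) n).symm
  rw [h, Finsupp.linearCombination_apply, Finsupp.sum]
  refine Finset.sum_eq_zero fun n _ => ?_
  by_cases hn : n < N
  · rw [ha n hn, smul_zero]
  · rw [hv n (not_lt.1 hn), zero_smul]

namespace LagrangianFrame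

variable {Z : Submodule ℂ HPrime} (Φ : LagrangianFrame Z)

/-- On `H'_+` only the adjoint acts, and each of its coefficients is a pairing with a fixed vector,
which vanishes on a deep lattice. Finitely many coefficients matter, because those of nonpositive
index are zero. -/
theorem isCts_liftEnd (a : Module.End ℂ FinSeq) : IsCts (Φ.liftEnd a) := by
  intro m
  choose N hN using fun n : ℕ => exists_symp_eq_zero (Φ.ι (a (seqBasis n)))
  refine ⟨max 1 ((Finset.range m.toNat).sup N : ℕ), fun f hf => ?_⟩
  rw [liftEnd_apply, negCoeffs_eq_zero_iff.2 (lattice_anti (le_max_left _ _) hf), map_zero,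
    map_zero, zero_sub]
  refine Submodule.neg_mem _ fun n hn => ?_
  rw [coeff_adjoint]
  split_ifs with h0
  · rw [hN _ f (lattice_anti ?_ hf), neg_zero, zero_div]
    refine le_trans ?_ (le_max_right _ _)
    exact_mod_cast Finset.le_sup (f := N)
      (Finset.mem_range.2 (show (n - 1).toNat < m.toNat by omega))
  · rfl

/-- The action of an endomorphism of the Lagrangian `Z` on `H'`, as an element of `sp(H')`. -/
def liftSp : Module.End ℂ FinSeq →ₗ[ℂ] sp :=
  LinearMap.codRestrict sp.toSubmodule Φ.liftEnd fun a =>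
    ⟨(Φ.isCts_liftEnd a).continuous, Φ.symp_liftEnd a⟩

theorem coe_liftSp (a : Module.End ℂ FinSeq) : (Φ.liftSp a : Module.End ℂ HPrime) = Φ.liftEnd a :=
  rfl

/-- A series in `t ^ (-N) ℂ⟦t⟧` involves only the first `N` basis vectors of `FinSeq`, which `a`
kills. The coefficient of `t ^ n` in the adjoint involves basis vector `n - 1`, also killed for `n <
N`. -/
theorem liftSp_mem_spNhd {N : ℕ} {a : Module.End ℂ FinSeq} (ha : a ∈ annihilators N) :
    Φ.liftSp a ∈ spNhd N := by
  intro f hf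
  rw [coe_liftSp, liftEnd_apply, apply_eq_zero_of_mem_annihilators ha (v := negCoeffs f)
    fun n hn => hf _ (by omega), map_zero, zero_sub]
  refine Submodule.neg_mem _ fun n hn => ?_
  rw [coeff_adjoint]
  split_ifs with h0
  · rw [ha _ (by omega)]
    simp
  · rfl

/-- An element of `sp(H')` which vanishes on `Z` has image in `Z`. -/
theorem apply_mem_of_forall_eq_zero (Φ : LagrangianFrame Z) {X : sp}
    (hX : ∀ z ∈ Z, (X : Module.End ℂ HPrime) z = 0) (f : HPrime) :
    (X : Module.End ℂ HPrime) f ∈ Z :=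
  Φ.lagrangian.mem_of_symp_eq_zero fun z hz => by
    have h := X.2.2 z f
    rwa [hX z hz, map_zero, LinearMap.zero_apply, zero_add] at h

/-- As `X` kills `Z`, its image lies in `Z` and equals `X(H'_+) ⊆ H'_+`, and these two meet in zero.
This rigidity gives identities in `sp(H')` by checking them on `Z` alone. -/
theorem sp_eq_zero (Φ : LagrangianFrame Z) {X : sp}
    (hX : ∀ z ∈ Z, (X : Module.End ℂ HPrime) z = 0)
    (hX' : ∀ f ∈ HPlus, (X : Module.End ℂ HPrime) f ∈ HPlus) : X = 0 := by
  refine Subtype.ext (LinearMap.ext fun f => ?_)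
  have h : (X : Module.End ℂ HPrime) f = (X : Module.End ℂ HPrime) (f - Φ.ι (negCoeffs f)) := by
    rw [map_sub, hX _ (Φ.mem _), sub_zero]
  refine Φ.eq_zero_of_mem (Φ.apply_mem_of_forall_eq_zero hX f) ?_
  rw [h]
  exact hX' _ (Φ.sub_mem_HPlus f)

theorem coe_lie_apply (X Y : sp) (f : HPrime) : ((⁅X, Y⁆ : sp) : Module.End ℂ HPrime) f
    = (X : Module.End ℂ HPrime) ((Y : Module.End ℂ HPrime) f)
      - (Y : Module.End ℂ HPrime) ((X : Module.End ℂ HPrime) f) := rfl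

theorem liftSp_commutator (a b : Module.End ℂ FinSeq) :
    Φ.liftSp (a * b - b * a) = ⁅Φ.liftSp a, Φ.liftSp b⁆ := by
  rw [← sub_eq_zero]
  refine Φ.sp_eq_zero (fun z hz => ?_) fun f hf => ?_
  · change Φ.liftEnd (a * b - b * a) z
      - (Φ.liftEnd a (Φ.liftEnd b z) - Φ.liftEnd b (Φ.liftEnd a z)) = 0
    simp only [Φ.liftEnd_of_mem _ hz, Φ.liftEnd_of_mem _ (Φ.mem _), Φ.negCoeffs_ι,
      LinearMap.sub_apply, Module.End.mul_apply, map_sub, sub_self]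
  · change Φ.liftEnd (a * b - b * a) f
      - (Φ.liftEnd a (Φ.liftEnd b f) - Φ.liftEnd b (Φ.liftEnd a f)) ∈ HPlus
    exact HPlus.sub_mem (Φ.liftEnd_of_mem_HPlus _ hf) (HPlus.sub_mem
      (Φ.liftEnd_of_mem_HPlus _ (Φ.liftEnd_of_mem_HPlus _ hf))
      (Φ.liftEnd_of_mem_HPlus _ (Φ.liftEnd_of_mem_HPlus _ hf)))

/-- The compression of an endomorphism of `H'` to `Z`. -/
def compress : sp →ₗ[ℂ] Module.End ℂ FinSeq where
  toFun X := negCoeffs ∘ₗ (X : Module.End ℂ HPrime) ∘ₗ Φ.ι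
  map_add' X Y := by ext; simp
  map_smul' r X := by ext; simp

theorem compress_apply (X : sp) (v : FinSeq) :
    Φ.compress X v = negCoeffs ((X : Module.End ℂ HPrime) (Φ.ι v)) := rfl

theorem ι_compress {X : sp} (hX : ∀ z ∈ Z, (X : Module.End ℂ HPrime) z ∈ Z) (v : FinSeq) :
    Φ.ι (Φ.compress X v) = (X : Module.End ℂ HPrime) (Φ.ι v) :=
  Φ.ι_negCoeffs _ (hX _ (Φ.mem v))

theorem compress_lie {X Y : sp} (hX : ∀ z ∈ Z, (X : Module.End ℂ HPrime) z ∈ Z)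
    (hY : ∀ z ∈ Z, (Y : Module.End ℂ HPrime) z ∈ Z) :
    Φ.compress ⁅X, Y⁆ = Φ.compress X * Φ.compress Y - Φ.compress Y * Φ.compress X := by
  refine LinearMap.ext fun v => ?_
  rw [LinearMap.sub_apply, Module.End.mul_apply, Module.End.mul_apply, compress_apply,
    Φ.compress_apply X, Φ.compress_apply Y (Φ.compress X v), Φ.ι_compress hX, Φ.ι_compress hY, ← map_sub]
  rfl

theorem liftSp_compress_apply {X : sp} (hX : ∀ z ∈ Z, (X : Module.End ℂ HPrime) z ∈ Z)
    {z : HPrime} (hz : z ∈ Z) : (Φ.liftSp (Φ.compress X) : Module.End ℂ HPrime) z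
      = (X : Module.End ℂ HPrime) z := by
  rw [coe_liftSp, Φ.liftEnd_of_mem _ hz, Φ.ι_compress hX, Φ.ι_negCoeffs z hz]

/-- The compression kills a basis vector exactly when `X` sends its lift into `H'_+`, which any `X`
close enough to `0` does. -/
theorem exists_compress_mem_annihilators (M : ℕ) :
    ∃ N, ∀ X ∈ spNhd N, Φ.compress X ∈ annihilators M := by
  choose f hf using fun n : ℕ => exists_mem_lattice (Φ.ι (seqBasis n))
  -- The summand `1` places the values in `t ℂ⟦t⟧`; the supremum covers the poles of the first `M`
  -- lifted basis vectors.
  refine ⟨1 + (Finset.range M).sup fun n => (-f n).toNat, fun X hX n hn => ?_⟩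
  rw [compress_apply, negCoeffs_eq_zero_iff]
  refine lattice_anti (by omega) (hX _ (lattice_anti ?_ (hf n)))
  have h := Finset.le_sup (f := fun n => (-f n).toNat) (Finset.mem_range.2 hn)
  omega

end LagrangianFrame

/-- A bilinear form on a Lie algebra that is a two-cocycle with trivial coefficients. -/
structure IsLieCocycle {L : Type*} [LieRing L] [LieAlgebra ℂ L] (c : L →ₗ[ℂ] L →ₗ[ℂ] ℂ) :
    Prop where
  skew : ∀ x y, c y x = -c x y
  jacobi : ∀ x y z, c ⁅x, y⁆ z + c ⁅y, z⁆ x + c ⁅z, x⁆ y = 0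

/-- Homogeneous elements whose total weight is not zero pair through a coboundary. -/
theorem IsLieCocycle.apply_of_weight {L : Type*} [LieRing L] [LieAlgebra ℂ L]
    {c : L →ₗ[ℂ] L →ₗ[ℂ] ℂ} (hc : IsLieCocycle c) {h x y : L} {m n : ℂ} (hx : ⁅h, x⁆ = m • x)
    (hy : ⁅h, y⁆ = n • y) : (m + n) * c x y = c h ⁅x, y⁆ := by
  have e := hc.jacobi h x y
  rw [hx, ← lie_skew y h, hy, hc.skew h, map_smul, map_neg, map_smul, LinearMap.neg_apply,
    LinearMap.smul_apply, LinearMap.smul_apply, hc.skew x y, smul_eq_mul, smul_eq_mul] at e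
  linear_combination e

theorem continuous_right : Continuous fun x : SpH => x.right :=
  continuous_fst.comp (continuous_induced_dom (f := fun x : SpH => (x.right, x.left)))

theorem continuous_left : Continuous fun x : SpH => x.left :=
  continuous_snd.comp (continuous_induced_dom (f := fun x : SpH => (x.right, x.left)))

theorem continuous_mk_SpH {T : Type*} [TopologicalSpace T] {f : T → HPrime} {X : T → sp}
    (hf : Continuous f) (hX : Continuous X) : Continuous fun t => (⟨f t, X t⟩ : SpH) :=
  continuous_induced_rng.2 (hX.prodMk hf)

theorem eventually_of_tendsto {G K : Type*} [AddCommGroup G] [TopologicalSpace G] [AddCommGroup K]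
    [TopologicalSpace K] {L : G → K} (hL : Continuous L) (h0 : L 0 = 0) {p : K → Prop}
    (hp : ∀ᶠ x in 𝓝 0, p x) : ∀ᶠ x in 𝓝 0, p (L x) := by
  have h := hL.tendsto 0
  rw [h0] at h
  exact h.eventually hp

/-- The conditions on `x = X + f` to lie in `sp_Z(H') ⋉ Z`. -/
def Preserves (Z : Submodule ℂ HPrime) (x : SpH) : Prop :=
  (∀ z ∈ Z, (x.right : Module.End ℂ HPrime) z ∈ Z) ∧ x.left ∈ Z

/-! ### The stabilizer of `Z`, graded by weights 0, 1 and 2 -/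

namespace LagrangianFrame

variable {Z : Submodule ℂ HPrime} (Φ : LagrangianFrame Z)

/-- The embedding of `gl(Z)` into `sp(H') ⋉ H'`. -/
def embed : Module.End ℂ FinSeq →ₗ[ℂ] SpH where
  toFun a := ⟨0, Φ.liftSp a⟩
  map_add' a b := by rw [map_add, LieAlgebra.SemiDirectSum.add_eq_mk, add_zero]
  map_smul' r a := by
    rw [map_smul, LieAlgebra.SemiDirectSum.smul_eq_mk, smul_zero, RingHom.id_apply]

theorem embed_commutator (a b : Module.End ℂ FinSeq) :
    Φ.embed (a * b - b * a) = ⁅Φ.embed a, Φ.embed b⁆ := by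
  rw [SpH.lie_def]
  change (⟨0, Φ.liftSp (a * b - b * a)⟩ : SpH)
    = ⟨(Φ.liftSp a : Module.End ℂ HPrime) 0 - (Φ.liftSp b : Module.End ℂ HPrime) 0, _⟩
  rw [map_zero, map_zero, sub_zero, Φ.liftSp_commutator]
  rfl

/-- The component in `gl(Z)` of an element of `sp(H') ⋉ H'`. -/
def levi : SpH →ₗ[ℂ] Module.End ℂ FinSeq :=
  Φ.compress ∘ₗ (LieAlgebra.SemiDirectSum.projr spAction).toLinearMap

theorem levi_apply (x : SpH) : Φ.levi x = Φ.compress x.right := rfl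

/-- The component in `H'` of an element of `sp(H') ⋉ H'`. -/
def linearPart : SpH →ₗ[ℂ] SpH where
  toFun x := ⟨x.left, 0⟩
  map_add' x y := by simp
  map_smul' r x := by simp

theorem linearPart_apply (x : SpH) : linearPart x = ⟨x.left, 0⟩ := rfl

/-- The component of an element of `sp(H') ⋉ H'` which vanishes on `Z`, if it preserves `Z`. -/
def quadraticPart : SpH →ₗ[ℂ] SpH := LinearMap.id - Φ.embed ∘ₗ Φ.levi - linearPart

theorem quadraticPart_apply (x : SpH) :
    Φ.quadraticPart x = ⟨0, x.right - Φ.liftSp (Φ.compress x.right)⟩ := by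
  change x - Φ.embed (Φ.levi x) - linearPart x = _
  rw [linearPart_apply, levi_apply]
  change x - ⟨0, Φ.liftSp (Φ.compress x.right)⟩ - ⟨x.left, 0⟩ = _
  ext : 1 <;> simp

theorem decompose (x : SpH) : x = Φ.embed (Φ.levi x) + linearPart x + Φ.quadraticPart x := by
  change x = Φ.embed (Φ.levi x) + linearPart x + (x - Φ.embed (Φ.levi x) - linearPart x)
  abel

theorem levi_lie {x y : SpH} (hx : Preserves Z x) (hy : Preserves Z y) :
    Φ.levi ⁅x, y⁆ = Φ.levi x * Φ.levi y - Φ.levi y * Φ.levi x := by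
  rw [levi_apply, SpH.lie_def]
  exact Φ.compress_lie hx.1 hy.1

theorem quadraticPart_right_apply {x : SpH} (hx : Preserves Z x) {z : HPrime} (hz : z ∈ Z) :
    ((Φ.quadraticPart x).right : Module.End ℂ HPrime) z = 0 := by
  rw [quadraticPart_apply]
  change (x.right : Module.End ℂ HPrime) z - (Φ.liftSp _ : Module.End ℂ HPrime) z = 0
  rw [Φ.liftSp_compress_apply hx.1 hz, sub_self]

theorem lie_embed_linearPart {x y : SpH} (hx : Preserves Z x) (hy : Preserves Z y) :
    ⁅Φ.embed (Φ.levi x), linearPart y⁆ = ⟨(x.right : Module.End ℂ HPrime) y.left, 0⟩ := by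
  rw [SpH.lie_def]
  change (⟨(Φ.liftSp (Φ.compress x.right) : Module.End ℂ HPrime) y.left - (0 : HPrime),
    ⁅_, (0 : sp)⁆⟩ : SpH) = _
  rw [lie_zero, Φ.liftSp_compress_apply hx.1 hy.2, sub_zero]

theorem linearPart_lie {x y : SpH} (hx : Preserves Z x) (hy : Preserves Z y) :
    linearPart ⁅x, y⁆
      = ⁅Φ.embed (Φ.levi x), linearPart y⁆ - ⁅Φ.embed (Φ.levi y), linearPart x⁆ := by
  rw [Φ.lie_embed_linearPart hx hy, Φ.lie_embed_linearPart hy hx, SpH.lie_def, linearPart_apply]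
  simp

theorem lie_linearPart_linearPart (x y : SpH) : ⁅linearPart x, linearPart y⁆ = 0 := by
  rw [SpH.lie_def]
  change (⟨(0 : HPrime) - (0 : HPrime), ⁅(0 : sp), (0 : sp)⁆⟩ : SpH) = _
  rw [lie_zero, sub_zero]
  rfl

theorem lie_linearPart_quadraticPart {x y : SpH} (hx : Preserves Z x) (hy : Preserves Z y) :
    ⁅linearPart x, Φ.quadraticPart y⁆ = 0 := by
  rw [SpH.lie_def]
  change (⟨(0 : HPrime) - ((Φ.quadraticPart y).right : Module.End ℂ HPrime) x.left,
    ⁅(0 : sp), _⁆⟩ : SpH) = _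
  rw [zero_lie, Φ.quadraticPart_right_apply hy hx.2, sub_zero]
  rfl

theorem quadraticPart_left (x : SpH) : (Φ.quadraticPart x).left = 0 := by
  rw [quadraticPart_apply]

/-- Both maps kill `Z` and take values in `Z`, so either composite is zero. -/
theorem lie_quadraticPart_quadraticPart {x y : SpH} (hx : Preserves Z x) (hy : Preserves Z y) :
    ⁅Φ.quadraticPart x, Φ.quadraticPart y⁆ = 0 := by
  rw [SpH.lie_def, quadraticPart_left, quadraticPart_left, map_zero, map_zero, sub_zero]
  have h : ⁅(Φ.quadraticPart x).right, (Φ.quadraticPart y).right⁆ = 0 := by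
    refine Subtype.ext (LinearMap.ext fun f => ?_)
    rw [coe_lie_apply, Φ.quadraticPart_right_apply hx (Φ.apply_mem_of_forall_eq_zero
      (fun z hz => Φ.quadraticPart_right_apply hy hz) f), Φ.quadraticPart_right_apply hy
      (Φ.apply_mem_of_forall_eq_zero (fun z hz => Φ.quadraticPart_right_apply hx hz) f), sub_zero]
    rfl
  rw [h]
  rfl

theorem quadraticPart_lie {x y : SpH} (hx : Preserves Z x) (hy : Preserves Z y) :
    Φ.quadraticPart ⁅x, y⁆
      = ⁅Φ.embed (Φ.levi x), Φ.quadraticPart y⁆ - ⁅Φ.embed (Φ.levi y), Φ.quadraticPart x⁆ := by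
  -- Expand the bracket through the components of `x` and `y`: brackets of two positive-weight
  -- components vanish, and the components of weight 0 and 1 of the result are already known, so the
  -- rest is the component of weight 2.
  have h := Φ.decompose ⁅x, y⁆
  rw [Φ.levi_lie hx hy, Φ.embed_commutator, Φ.linearPart_lie hx hy] at h
  nth_rw 1 [Φ.decompose x, Φ.decompose y] at h
  simp only [add_lie, lie_add, Φ.lie_linearPart_quadraticPart hx hy,
    Φ.lie_quadraticPart_quadraticPart hx hy, lie_linearPart_linearPart] at h
  rw [← lie_skew (linearPart x) (Φ.embed (Φ.levi y)),
    ← lie_skew (Φ.quadraticPart x) (Φ.embed (Φ.levi y)),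
    ← lie_skew (Φ.quadraticPart x) (linearPart y), Φ.lie_linearPart_quadraticPart hy hx] at h
  rw [← sub_eq_zero] at h ⊢
  rw [← neg_eq_zero, ← h]
  abel

theorem lie_embed_one_embed (a : Module.End ℂ FinSeq) :
    ⁅Φ.embed 1, Φ.embed a⁆ = (0 : ℂ) • Φ.embed a := by
  have h : (1 : Module.End ℂ FinSeq) * a - a * 1 = 0 := by
    rw [one_mul, mul_one]
    exact sub_self a
  rw [← embed_commutator, h, map_zero, zero_smul]

theorem liftSp_one_of_mem {z : HPrime} (hz : z ∈ Z) :
    (Φ.liftSp 1 : Module.End ℂ HPrime) z = z := by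
  rw [coe_liftSp, Φ.liftEnd_of_mem _ hz, Module.End.one_apply, Φ.ι_negCoeffs z hz]

/-- The adjoint of the identity fixes `f`: the difference lies in `H'_+` and is orthogonal to `Z`,
hence lies in `Z ∩ H'_+ = 0`. -/
theorem liftSp_one_of_mem_HPlus {f : HPrime} (hf : f ∈ HPlus) :
    (Φ.liftSp 1 : Module.End ℂ HPrime) f = -f := by
  rw [coe_liftSp, liftEnd_apply, negCoeffs_eq_zero_iff.2 hf, map_zero, map_zero, zero_sub, neg_inj,
    ← sub_eq_zero]
  refine Φ.eq_zero_of_mem (Φ.lagrangian.mem_of_symp_eq_zero fun z hz => ?_)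
    (HPlus.sub_mem (Φ.adjoint_mem _ _) hf)
  rw [map_sub, symp_adjoint, Module.End.one_apply, Φ.ι_negCoeffs z hz, sub_self]

theorem lie_embed_one_linearPart {x : SpH} (hx : Preserves Z x) :
    ⁅Φ.embed 1, linearPart x⁆ = (1 : ℂ) • linearPart x := by
  rw [SpH.lie_def]
  change (⟨(Φ.liftSp 1 : Module.End ℂ HPrime) x.left - (0 : HPrime), ⁅_, (0 : sp)⁆⟩ : SpH) = _
  rw [lie_zero, Φ.liftSp_one_of_mem hx.2, sub_zero, one_smul]
  rfl

/-- A map that kills `Z` and takes values in `Z` carries `H' / Z`, where `h` acts by `-1`, to `Z`,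
where it acts by `1`; the weight is `1 - (-1) = 2`. -/
theorem lie_embed_one_quadraticPart {x : SpH} (hx : Preserves Z x) :
    ⁅Φ.embed 1, Φ.quadraticPart x⁆ = (2 : ℂ) • Φ.quadraticPart x := by
  have h0 := fun z hz => Φ.quadraticPart_right_apply hx (z := z) hz
  rw [SpH.lie_def]
  refine LieAlgebra.SemiDirectSum.ext ?_ (Subtype.ext (LinearMap.ext fun f => ?_))
  · change (Φ.liftSp 1 : Module.End ℂ HPrime) (Φ.quadraticPart x).left
      - ((Φ.quadraticPart x).right : Module.End ℂ HPrime) 0 = (2 : ℂ) • (Φ.quadraticPart x).left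
    rw [quadraticPart_left, map_zero, map_zero, sub_zero, smul_zero]
  · change (Φ.liftSp 1 : Module.End ℂ HPrime) (((Φ.quadraticPart x).right : Module.End ℂ HPrime) f)
      - ((Φ.quadraticPart x).right : Module.End ℂ HPrime) ((Φ.liftSp 1 : Module.End ℂ HPrime) f)
      = (2 : ℂ) • ((Φ.quadraticPart x).right : Module.End ℂ HPrime) f
    rw [Φ.liftSp_one_of_mem (Φ.apply_mem_of_forall_eq_zero h0 f)]
    have h : (Φ.liftSp 1 : Module.End ℂ HPrime) f = Φ.ι (negCoeffs f) - (f - Φ.ι (negCoeffs f)) := by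
      rw [← Φ.liftSp_one_of_mem (Φ.mem (negCoeffs f)), sub_eq_add_neg,
        Φ.liftSp_one_of_mem (Φ.mem (negCoeffs f)),
        ← Φ.liftSp_one_of_mem_HPlus (Φ.sub_mem_HPlus f), map_sub,
        Φ.liftSp_one_of_mem (Φ.mem (negCoeffs f))]
      abel
    rw [h, map_sub, map_sub, h0 _ (Φ.mem _), two_smul]
    abel

theorem eventually_levi_mem {M : ℕ} : ∀ᶠ x in 𝓝 (0 : SpH), Φ.levi x ∈ annihilators M := by
  obtain ⟨N, hN⟩ := Φ.exists_compress_mem_annihilators M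
  exact eventually_of_tendsto (L := fun x : SpH => x.right) continuous_right rfl
    (Filter.mem_of_superset (nhds_zero_sp.mem_of_mem trivial) hN)

/-- Every separately continuous cocycle on `sp(H') ⋉ H'` restricts to a coboundary on the
subalgebra which preserves the Lagrangian subspace `Z`. -/
theorem exists_primitive (Φ : LagrangianFrame Z) {c : SpH →ₗ[ℂ] SpH →ₗ[ℂ] ℂ} (hc : IsLieCocycle c)
    (hcont : ∀ y, ∀ᶠ x in 𝓝 0, c x y = 0) :
    ∃ l : SpH →ₗ[ℂ] ℂ, (∀ᶠ x in 𝓝 0, l x = 0) ∧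
      ∀ x y, Preserves Z x → Preserves Z y → c x y = l ⁅x, y⁆ := by
  set c₀ : Module.End ℂ FinSeq →ₗ[ℂ] Module.End ℂ FinSeq →ₗ[ℂ] ℂ := c.compl₁₂ Φ.embed Φ.embed
  have hc₀ : IsCommutatorCocycle (A := Module.End ℂ FinSeq) c₀ :=
    { skew := fun a b => hc.skew _ _
      jacobi := fun a b d => by
        have h := hc.jacobi (Φ.embed a) (Φ.embed b) (Φ.embed d)
        rw [← embed_commutator, ← embed_commutator, ← embed_commutator] at h
        exact h }
  have small : ∀ {p : SpH → Prop}, (∀ᶠ x in 𝓝 0, p x) →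
      ∃ N, ∀ a ∈ annihilators N, p (Φ.embed a) := by
    intro p hp
    have hp' : ∀ᶠ X in 𝓝 (0 : sp), p ⟨0, X⟩ :=
      eventually_of_tendsto (L := fun X : sp => (⟨0, X⟩ : SpH))
        (continuous_mk_SpH continuous_const continuous_id) rfl hp
    obtain ⟨N, -, hN⟩ := nhds_zero_sp.eventually_iff.1 hp'
    exact ⟨N, fun a ha => hN (Φ.liftSp_mem_spNhd ha)⟩
  obtain ⟨N, hN⟩ := exists_annihilators_primitive hc₀ fun b => small (hcont (Φ.embed b))
  set μ := endInfiniteSum.primitive c₀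
  set h := Φ.embed 1
  -- Weight 0 uses the primitive on the infinite sum ring. In weights 1 and 2 the factors `1` and `1
  -- / 2` are the inverse weights dictated by `apply_of_weight`.
  refine ⟨μ ∘ₗ Φ.levi + c h ∘ₗ linearPart + (1 / 2 : ℂ) • (c h ∘ₗ Φ.quadraticPart), ?_, ?_⟩
  · have hh : ∀ᶠ x in 𝓝 (0 : SpH), c h x = 0 := by
      filter_upwards [hcont h] with x hx
      rw [hc.skew, hx, neg_zero]
    obtain ⟨M, hM⟩ := small hh
    have hlin : ∀ᶠ x in 𝓝 (0 : SpH), c h (linearPart x) = 0 :=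
      eventually_of_tendsto (L := linearPart) (continuous_mk_SpH continuous_left continuous_const)
        (map_zero _) hh
    filter_upwards [hh, hlin, Φ.eventually_levi_mem (M := M), Φ.eventually_levi_mem (M := N)] with x h1 h2 h3 h4
    -- The quadratic part is `x` minus its other two components, and `c h` vanishes on all three for
    -- small `x`.
    have h5 : c h (Φ.quadraticPart x) = 0 := by
      change c h (x - Φ.embed (Φ.levi x) - linearPart x) = 0
      rw [map_sub, map_sub, h1, h2, hM _ h3, sub_zero, sub_zero]
    simp only [LinearMap.add_apply, LinearMap.comp_apply, LinearMap.smul_apply, h2, h5,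
      hN _ h4, smul_zero, add_zero]
  · intro x y hx hy
    have e00 : c (Φ.embed (Φ.levi x)) (Φ.embed (Φ.levi y)) = μ (Φ.levi ⁅x, y⁆) := by
      rw [Φ.levi_lie hx hy]
      exact endInfiniteSum.eq_primitive_commutator hc₀ _ _
    have w0 := fun z => Φ.lie_embed_one_embed (Φ.levi z)
    have w1x := Φ.lie_embed_one_linearPart hx
    have w1y := Φ.lie_embed_one_linearPart hy
    have w2x := Φ.lie_embed_one_quadraticPart hx
    have w2y := Φ.lie_embed_one_quadraticPart hy
    have e01 := hc.apply_of_weight (w0 x) w1y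
    have e10 := hc.apply_of_weight (w0 y) w1x
    have e02 := hc.apply_of_weight (w0 x) w2y
    have e20 := hc.apply_of_weight (w0 y) w2x
    have e11 := hc.apply_of_weight w1x w1y
    have e12 := hc.apply_of_weight w1x w2y
    have e21 := hc.apply_of_weight w1y w2x
    have e22 := hc.apply_of_weight w2x w2y
    rw [lie_linearPart_linearPart, map_zero] at e11
    rw [Φ.lie_linearPart_quadraticPart hx hy, map_zero] at e12
    rw [Φ.lie_linearPart_quadraticPart hy hx, map_zero] at e21
    rw [Φ.lie_quadraticPart_quadraticPart hx hy, map_zero] at e22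
    simp only [LinearMap.add_apply, LinearMap.comp_apply, LinearMap.smul_apply, smul_eq_mul]
    rw [Φ.linearPart_lie hx hy, Φ.quadraticPart_lie hx hy, map_sub, map_sub, ← e00, ← e01, ← e10,
      ← e02, ← e20]
    nth_rw 1 [Φ.decompose x, Φ.decompose y]
    simp only [map_add, LinearMap.add_apply]
    rw [hc.skew (Φ.embed (Φ.levi y)) (linearPart x), hc.skew (Φ.embed (Φ.levi y)) (Φ.quadraticPart x),
      hc.skew (linearPart y) (Φ.quadraticPart x)]
    -- The brackets inside weights 1 and 2 vanish, so these pairings are zero after division by the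
    -- total weights `1 + 1`, `1 + 2` and `2 + 2`.
    linear_combination (1 / 2 : ℂ) * e11 + (1 / 3 : ℂ) * e12 - (1 / 3 : ℂ) * e21 + (1 / 4 : ℂ) * e22

end LagrangianFrame
instance : IsTopologicalAddGroup SpH :=
  topologicalAddGroup_induced (LieAlgebra.SemiDirectSum.toProdl spAction ≪≫ₗ
    LinearEquiv.prodComm ℂ HPrime sp).toLinearMap

/-! ### Splittings from primitives -/

section Splitting

variable {g : Type} [LieRing g] [LieAlgebra ℂ g]

theorem exists_incl_eq (E : LieAlgebra.Extension ℂ ℂ g) {x : E.L} (hx : E.proj x = 0) :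
    ∃ r : ℂ, E.incl r = x := by
  have h : x ∈ E.incl.range := by
    rw [E.IsExtension.exact]
    exact hx
  exact h

theorem lie_lie_jacobi {L : Type*} [LieRing L] (x y z : L) :
    ⁅⁅x, y⁆, z⁆ + ⁅⁅y, z⁆, x⁆ + ⁅⁅z, x⁆, y⁆ = 0 := by
  have h := lie_jacobi x y z
  rw [← lie_skew x ⁅y, z⁆, ← lie_skew y ⁅z, x⁆, ← lie_skew z ⁅x, y⁆] at h
  rw [← neg_eq_zero, ← h]
  abel

/-- The two-cocycle of a central extension with a linear section. -/
theorem exists_cocycle (E : LieAlgebra.Extension ℂ ℂ g)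
    (hE : ∀ (r : ℂ) (x : E.L), ⁅E.incl r, x⁆ = 0) {s : g →ₗ[ℂ] E.L}
    (hs : ∀ x, E.proj (s x) = x) : ∃ c : g →ₗ[ℂ] g →ₗ[ℂ] ℂ, IsLieCocycle c ∧
      ∀ x y, E.incl (c x y) = ⁅s x, s y⁆ - s ⁅x, y⁆ := by
  have hex : ∀ x y, ∃ r : ℂ, E.incl r = ⁅s x, s y⁆ - s ⁅x, y⁆ := fun x y =>
    exists_incl_eq E (by rw [map_sub, LieHom.map_lie, hs, hs, hs, sub_self])
  choose c hc using hex
  have inj := E.incl_injective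
  refine ⟨LinearMap.mk₂ ℂ c (fun x x' y => inj ?_) (fun r x y => inj ?_) (fun x y y' => inj ?_)
    (fun r x y => inj ?_), ⟨fun x y => inj ?_, fun x y z => inj ?_⟩, hc⟩
  · simp only [map_add, hc, add_lie]; abel
  · simp only [map_smul, hc, smul_lie, smul_sub]
  · simp only [map_add, hc, lie_add]; abel
  · simp only [map_smul, hc, lie_smul, smul_sub]
  · change E.incl (c y x) = E.incl (-c x y)
    rw [map_neg, hc, hc, ← lie_skew (s x), ← lie_skew x, map_neg]
    abel
  · change E.incl (c ⁅x, y⁆ z + c ⁅y, z⁆ x + c ⁅z, x⁆ y) = E.incl 0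
    have key : ∀ x y z, E.incl (c ⁅x, y⁆ z) = ⁅⁅s x, s y⁆, s z⁆ - s ⁅⁅x, y⁆, z⁆ := by
      intro x y z
      -- `s ⁅x, y⁆` and `⁅s x, s y⁆` differ by a central element, so the cocycle identity follows
      -- from the Jacobi identities of `E` and of `g`.
      have h : s ⁅x, y⁆ = ⁅s x, s y⁆ - E.incl (c x y) := by rw [hc]; abel
      rw [hc, h, sub_lie, hE, sub_zero]
    have j1 := lie_lie_jacobi (s x) (s y) (s z)
    have j2 := congrArg s (lie_lie_jacobi x y z)
    rw [map_add, map_add, map_zero] at j2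
    rw [map_add, map_add, key, key, key, map_zero, ← sub_eq_zero.2 (j1.trans j2.symm)]
    abel

variable [TopologicalSpace g]

/-- Continuity of `c(·, y)` becomes vanishing on an open subspace: neighbourhoods of `0` may be
taken to be subspaces, and a linear form omitting the value `1` on a subspace is zero there. Only
the Hausdorff topology of `E` is used, with no topology chosen on `gl_1`. -/
theorem IsContinuousCentral.exists_cocycle {E : LieAlgebra.Extension ℂ ℂ g} [TopologicalSpace E.L]
    (hE : IsContinuousCentral E) {B : ℕ → Submodule ℂ g}
    (hB : (𝓝 (0 : g)).HasBasis (fun _ => True) fun n => (B n : Set g)) :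
    ∃ (s : g →ₗ[ℂ] E.L) (c : g →ₗ[ℂ] g →ₗ[ℂ] ℂ), Continuous s ∧ (∀ x, E.proj (s x) = x) ∧
      IsLieCocycle c ∧ (∀ x y, E.incl (c x y) = ⁅s x, s y⁆ - s ⁅x, y⁆) ∧
      ∀ y, ∀ᶠ x in 𝓝 0, c x y = 0 := by
  obtain ⟨s, hs, hps⟩ := hE.exists_section
  obtain ⟨c, hc, hcs⟩ := Metaplectic.exists_cocycle E hE.central hps
  refine ⟨s, c, hs, hps, hc, hcs, fun y => ?_⟩
  have := hE.t2
  have := hE.topologicalAddGroup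
  have hcl : Continuous fun x : g => ⁅s x, s y⁆ :=
    hE.continuous_lie.comp (hs.prodMk continuous_const)
  -- Continuity of the bracket of `g` is not assumed; it is inherited from `E` through `s` and the
  -- projection.
  have hlie : Continuous fun x : g => ⁅x, y⁆ := by
    have h := hE.continuous_proj.comp hcl
    refine h.congr fun x => ?_
    rw [Function.comp_apply, LieHom.map_lie, hps, hps]
  have hcont : Continuous fun x : g => E.incl (c x y) :=
    (hcl.sub (hs.comp hlie)).congr fun x => (hcs x y).symm
  have hne : E.incl 1 ≠ (0 : E.L) := fun h =>
    one_ne_zero (E.incl_injective (h.trans (map_zero E.incl).symm))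
  have hev : ∀ᶠ x in 𝓝 (0 : g), E.incl (c x y) ≠ E.incl 1 := by
    refine hcont.continuousAt.eventually_ne ?_
    rw [map_zero, LinearMap.zero_apply, map_zero]
    exact hne.symm
  obtain ⟨n, -, hn⟩ := hB.eventually_iff.1 hev
  refine hB.eventually_iff.2 ⟨n, trivial, fun x hx => ?_⟩
  by_contra h0
  -- A nonzero value could be rescaled to `1` inside the subspace `B n`, where this value is
  -- excluded.
  refine hn ((B n).smul_mem (c x y)⁻¹ hx) ?_
  rw [map_smul, LinearMap.smul_apply, smul_eq_mul, inv_mul_cancel₀ h0]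

/-- The corrected section `s + l` is multiplicative on `k`: the central term does not change
brackets, and the defect `c x y` of `s` is exactly `l ⁅x, y⁆`. It stays continuous because `l`
vanishes near `0`. -/
theorem splitsOver_of_primitive [IsTopologicalAddGroup g] {E : LieAlgebra.Extension ℂ ℂ g}
    [TopologicalSpace E.L] (hE : IsContinuousCentral E) {k : LieSubalgebra ℂ g}
    {s : g →ₗ[ℂ] E.L} (hs : Continuous s) (hps : ∀ x, E.proj (s x) = x) {c : g →ₗ[ℂ] g →ₗ[ℂ] ℂ}
    (hcs : ∀ x y, E.incl (c x y) = ⁅s x, s y⁆ - s ⁅x, y⁆) {l : g →ₗ[ℂ] ℂ}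
    (hl : ∀ᶠ x in 𝓝 0, l x = 0) (hcl : ∀ x ∈ k, ∀ y ∈ k, c x y = l ⁅x, y⁆) : SplitsOver E k := by
  have := hE.topologicalAddGroup
  set σ : g →ₗ[ℂ] E.L := s + E.incl.toLinearMap ∘ₗ l with hσ
  have σ_apply : ∀ x, σ x = s x + E.incl (l x) := fun _ => rfl
  have hσc : Continuous σ := by
    refine hs.add ?_
    refine continuous_of_continuousAt_zero (E.incl.toLinearMap ∘ₗ l) ?_
    have h : (fun _ : g => (0 : E.L)) =ᶠ[𝓝 0] (E.incl.toLinearMap ∘ₗ l) := by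
      filter_upwards [hl] with x hx
      rw [LinearMap.comp_apply, hx, map_zero]
    exact continuousAt_const.congr h
  refine ⟨{ toLinearMap := σ ∘ₗ k.toSubmodule.subtype, map_lie' := ?_ },
    hσc.comp continuous_subtype_val, fun x => ?_⟩
  · intro x y
    change σ ⁅(x : g), (y : g)⁆ = ⁅σ x, σ y⁆
    have h : ∀ (r : ℂ) (z : E.L), ⁅z, E.incl r⁆ = 0 := fun r z => by
      rw [← lie_skew, hE.central, neg_zero]
    rw [σ_apply, σ_apply, σ_apply, ← hcl x x.2 y y.2, hcs, lie_add, add_lie, h, hE.central]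
    abel
  · change E.proj (σ x) = x
    rw [σ_apply, map_add, hps, LieAlgebra.Extension.proj_incl, add_zero]

end Splitting

/-- The basic neighbourhoods of `0` in `sp(H')` as subspaces. -/
def spNhdSubmodule (N : ℕ) : Submodule ℂ sp where
  carrier := spNhd N
  add_mem' hX hY f hf := Submodule.add_mem _ (hX f hf) (hY f hf)
  zero_mem' _ _ := Submodule.zero_mem _
  smul_mem' c _ hX f hf := Submodule.smul_mem _ c (hX f hf)

theorem spNhd_anti {M N : ℕ} (h : M ≤ N) : spNhd N ⊆ spNhd M := fun _ hX f hf =>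
  lattice_anti (by omega) (hX f (lattice_anti (by omega) hf))

/-- Basic neighbourhoods of `0` in `sp(H') ⋉ H'`. -/
def spHNhd (N : ℕ) : Submodule ℂ SpH :=
  (spNhdSubmodule N).comap (LieAlgebra.SemiDirectSum.projr spAction).toLinearMap ⊓
    (lattice N).comap (LieAlgebra.SemiDirectSum.projl spAction)

theorem nhds_zero_SpH :
    (𝓝 (0 : SpH)).HasBasis (fun _ : ℕ => True) fun n => (spHNhd n : Set SpH) := by
  have h : 𝓝 (0 : SpH) = comap (fun x : SpH => (x.right, x.left)) (𝓝 ((0 : sp), (0 : HPrime))) :=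
    nhds_induced _ _
  rw [h, nhds_prod_eq]
  refine ((nhds_zero_sp.prod nhds_zero_basis).comap _).to_hasBasis ?_ ?_
  · rintro ⟨n, m⟩ -
    refine ⟨max n m.toNat, trivial, fun x hx => ⟨spNhd_anti (le_max_left _ _) hx.1,
      lattice_anti ?_ hx.2⟩⟩
    have := le_max_right n m.toNat
    omega
  · rintro n -
    exact ⟨(n, n), ⟨trivial, trivial⟩, fun x hx => ⟨hx.1, hx.2⟩⟩

/-! ### Splitting over the stabilizers -/

section Main

variable {Z F : Submodule ℂ HPrime}

/-- As `F ⊆ Z` and `Z` is isotropic, `Z ⊆ F^⊥`; so `X(Z) ⊆ F ⊆ Z`. -/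
theorem preserves_of_mem_spFH (hZ : IsLagrangian Z) (hF : F ≤ Z) {hF' : F ≤ perp F} {x : SpH}
    (hx : x ∈ spFH F hF') : Preserves Z x := by
  refine ⟨fun z hz => hF (hx.1 z ?_), hF hx.2⟩
  exact mem_perp_iff.2 fun w hw => hZ.symp_eq_zero (hF hw) hz

theorem splitsOver_spFH (hZ : IsLagrangian Z) (hZP : Z ⊓ HPlus = ⊥) (hF : F ≤ Z)
    (E : LieAlgebra.Extension ℂ ℂ SpH) [TopologicalSpace E.L] (hE : IsContinuousCentral E) :
    SplitsOver E (spFH F (hZ.le_perp hF)) := by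
  obtain ⟨s, c, hs, hps, hc, hcs, hcont⟩ := hE.exists_cocycle nhds_zero_SpH
  obtain ⟨Φ⟩ := nonempty_lagrangianFrame hZ hZP
  obtain ⟨l, hl, hcl⟩ := Φ.exists_primitive hc hcont
  exact splitsOver_of_primitive hE hs hps hcs hl fun x hx y hy =>
    hcl x y (preserves_of_mem_spFH hZ hF hx) (preserves_of_mem_spFH hZ hF hy)

theorem splitsOver_spF (hZ : IsLagrangian Z) (hZP : Z ⊓ HPlus = ⊥) (hF : F ≤ Z)
    (E : LieAlgebra.Extension ℂ ℂ sp) [TopologicalSpace E.L] (hE : IsContinuousCentral E) :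
    SplitsOver E (spF F (hZ.le_perp hF)) := by
  obtain ⟨s, c, hs, hps, hc, hcs, hcont⟩ := hE.exists_cocycle (B := spNhdSubmodule) nhds_zero_sp
  obtain ⟨Φ⟩ := nonempty_lagrangianFrame hZ hZP
  set p := LieAlgebra.SemiDirectSum.projr spAction
  -- The cocycle is inflated to `sp(H') ⋉ H'`, where a primitive is available, and that primitive is
  -- restricted back to `sp(H')`.
  have hcp : IsLieCocycle (c.compl₁₂ p.toLinearMap p.toLinearMap) :=
    ⟨fun x y => hc.skew _ _, fun x y z => hc.jacobi x.right y.right z.right⟩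
  obtain ⟨l, hl, hcl⟩ := Φ.exists_primitive hcp fun y =>
    eventually_of_tendsto (L := fun x : SpH => x.right) continuous_right rfl (hcont y.right)
  refine splitsOver_of_primitive hE hs hps hcs
    (l := l ∘ₗ (LieAlgebra.SemiDirectSum.inr spAction).toLinearMap) ?_ fun X hX Y hY => ?_
  · exact eventually_of_tendsto (L := fun X : sp => (⟨0, X⟩ : SpH))
      (continuous_mk_SpH continuous_const continuous_id) rfl hl
  · have hmem : ∀ {X : sp}, X ∈ spF F (hZ.le_perp hF) →
        (⟨0, X⟩ : SpH) ∈ spFH F (hZ.le_perp hF) := fun hX => ⟨hX, F.zero_mem⟩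
    refine (hcl ⟨0, X⟩ ⟨0, Y⟩ (preserves_of_mem_spFH hZ hF (hmem hX))
      (preserves_of_mem_spFH hZ hF (hmem hY))).trans (congrArg l ?_)
    exact ((LieAlgebra.SemiDirectSum.inr spAction).map_lie X Y).symm

end Main

/-! ### The extensions `mp(H')` and `Ũ₂(H)` are continuous -/

/-- A biadditive map is continuous if it is so at `0`, jointly and in each variable. -/
theorem continuous_of_biadditive {A B C : Type*} [AddCommGroup A] [AddCommGroup B] [AddCommGroup C]
    [TopologicalSpace A] [TopologicalSpace B] [TopologicalSpace C] [IsTopologicalAddGroup A]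
    [IsTopologicalAddGroup B] [IsTopologicalAddGroup C] {f : A → B → C}
    (hl : ∀ x x' y, f (x + x') y = f x y + f x' y) (hr : ∀ x y y', f x (y + y') = f x y + f x y')
    (h0 : Tendsto (fun p : A × B => f p.1 p.2) (𝓝 0 ×ˢ 𝓝 0) (𝓝 0))
    (h1 : ∀ x, Tendsto (f x) (𝓝 0) (𝓝 0)) (h2 : ∀ y, Tendsto (fun x => f x y) (𝓝 0) (𝓝 0)) :
    Continuous fun p : A × B => f p.1 p.2 := by
  rw [continuous_iff_continuousAt]
  rintro ⟨a, b⟩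
  have ha : Tendsto (fun p : A × B => p.1 - a) (𝓝 (a, b)) (𝓝 0) := by
    have h : Continuous fun p : A × B => p.1 - a := continuous_fst.sub continuous_const
    simpa using h.tendsto (a, b)
  have hb : Tendsto (fun p : A × B => p.2 - b) (𝓝 (a, b)) (𝓝 0) := by
    have h : Continuous fun p : A × B => p.2 - b := continuous_snd.sub continuous_const
    simpa using h.tendsto (a, b)
  -- The expansion `f(x, y) = f(x - a, y - b) + f(a, y - b) + f(x - a, b) + f(a, b)`.
  have h := (((h0.comp (ha.prodMk hb)).add ((h1 a).comp hb)).add ((h2 b).comp ha)).add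
    (tendsto_const_nhds (x := f a b))
  rw [add_zero, add_zero, zero_add] at h
  refine h.congr fun p => ?_
  have e1 := hl (p.1 - a) a p.2
  have e2 := hr (p.1 - a) (p.2 - b) b
  have e3 := hr a (p.2 - b) b
  rw [sub_add_cancel] at e1 e2 e3
  rw [e1, e2, e3]
  simp only [Function.comp_apply]
  abel

section OfTwoCocycle

open LieModule.Cohomology

variable {g : Type} [LieRing g] [LieAlgebra ℂ g] [TopologicalSpace g] [IsTopologicalAddGroup g]
  [T2Space g] [ContinuousConstSMul ℂ g] [LieRingModule g ℂ] [LieModule ℂ g ℂ]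
  [LieModule.IsTrivial g ℂ]

/-- The extension defined by a locally constant two-cocycle is continuous. -/
theorem isContinuousCentral_ofTwoCocycle (hlie : Continuous fun p : g × g => ⁅p.1, p.2⁆)
    (c : twoCocycle ℂ g ℂ)
    (hc : @Continuous (g × g) ℂ _ ⊥ fun p => (c : g →ₗ[ℂ] g →ₗ[ℂ] ℂ) p.1 p.2) :
    @IsContinuousCentral g _ _ _ (LieAlgebra.Extension.ofTwoCocycle c)
      (TopologicalSpace.induced (fun x : LieAlgebra.ofTwoCocycle c => x.carrier)
        (@instTopologicalSpaceProd g ℂ _ ⊥)) := by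
  let : TopologicalSpace ℂ := ⊥
  have : DiscreteTopology ℂ := ⟨rfl⟩
  have : IsTopologicalAddGroup ℂ := inferInstance
  let τ : TopologicalSpace (LieAlgebra.ofTwoCocycle c) :=
    TopologicalSpace.induced (fun x : LieAlgebra.ofTwoCocycle c => x.carrier) inferInstance
  let _ : TopologicalSpace (LieAlgebra.Extension.ofTwoCocycle c).L := τ
  have hcar : Continuous fun x : LieAlgebra.ofTwoCocycle c => x.carrier := continuous_induced_dom
  have hfst : Continuous fun x : LieAlgebra.ofTwoCocycle c => x.carrier.1 :=
    continuous_fst.comp hcar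
  exact
    { central := fun r x => by
        change LieAlgebra.ofProd c (⁅(0 : g), x.carrier.1⁆,
          (c : g →ₗ[ℂ] g →ₗ[ℂ] ℂ) 0 x.carrier.1 + ⁅(0 : g), x.carrier.2⁆ - ⁅x.carrier.1, r⁆)
            = LieAlgebra.ofProd c 0
        rw [zero_lie, map_zero, zero_lie, trivial_lie_zero, LinearMap.zero_apply, add_zero,
          sub_zero]
        rfl
      t2 := by
        have hinj : Function.Injective fun x : LieAlgebra.ofTwoCocycle c => x.carrier :=
          fun x y h => by cases x; cases y; exact congrArg _ h
        exact T2Space.of_injective_continuous hinj hcar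
      topologicalAddGroup := topologicalAddGroup_induced
        (AddMonoidHom.mk' (fun x : LieAlgebra.ofTwoCocycle c => x.carrier) fun _ _ => rfl)
      continuous_smul := ⟨fun r => continuous_induced_rng.2
        ((hfst.const_smul r).prodMk
          ((continuous_of_discreteTopology (f := fun z : ℂ => r • z)).comp
            (continuous_snd.comp hcar)))⟩
      continuous_lie := by
        refine continuous_induced_rng.2 ?_
        have h1 : Continuous fun p : LieAlgebra.ofTwoCocycle c × LieAlgebra.ofTwoCocycle c =>
            (p.1.carrier.1, p.2.carrier.1) :=
          (hfst.comp continuous_fst).prodMk (hfst.comp continuous_snd)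
        refine ((hlie.comp h1).prodMk (hc.comp h1)).congr fun p => ?_
        change _ = (⁅p.1.carrier.1, p.2.carrier.1⁆, (c : g →ₗ[ℂ] g →ₗ[ℂ] ℂ) p.1.carrier.1
          p.2.carrier.1 + ⁅p.1.carrier.1, p.2.carrier.2⁆ - ⁅p.2.carrier.1, p.1.carrier.2⁆)
        rw [trivial_lie_zero g ℂ, trivial_lie_zero g ℂ, add_zero, sub_zero]
        rfl
      continuous_proj := hfst
      exists_section := ⟨
        { toFun := fun x => LieAlgebra.ofProd c (x, 0)
          map_add' := fun x y => by
            change LieAlgebra.ofProd c (x + y, (0 : ℂ)) = LieAlgebra.ofProd c (x + y, 0 + 0)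
            rw [add_zero]
          map_smul' := fun r x => by
            change LieAlgebra.ofProd c (r • x, (0 : ℂ)) = LieAlgebra.ofProd c (r • x, r • 0)
            rw [smul_zero] },
        continuous_induced_rng.2 (continuous_id.prodMk continuous_const), fun x => rfl⟩ }

end OfTwoCocycle

/-! ### Linear topologies and continuity of the brackets -/

section LinearTopology

variable {g : Type} [AddCommGroup g] [Module ℂ g] [TopologicalSpace g] [IsTopologicalAddGroup g]
  {B : ℕ → Submodule ℂ g}

theorem t2Space_of_basis (hB : (𝓝 (0 : g)).HasBasis (fun _ => True) fun n => (B n : Set g))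
    (h : ∀ x, (∀ n, x ∈ B n) → x = 0) : T2Space g := by
  refine IsTopologicalAddGroup.t2Space_of_zero_sep fun x hx => ?_
  by_contra! hU
  exact hx (h x fun n => hU _ (hB.mem_of_mem trivial))

theorem continuousConstSMul_of_basis
    (hB : (𝓝 (0 : g)).HasBasis (fun _ => True) fun n => (B n : Set g)) :
    ContinuousConstSMul ℂ g where
  continuous_const_smul r := by
    refine continuous_of_continuousAt_zero (LinearMap.lsmul ℂ g r) ?_
    rw [ContinuousAt, map_zero]
    exact (hB.tendsto_iff hB).2 fun n _ => ⟨n, trivial, fun x hx => (B n).smul_mem r hx⟩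

end LinearTopology

theorem eq_zero_of_forall_mem_lattice {f : HPrime} (h : ∀ n : ℕ, f ∈ lattice n) : f = 0 :=
  HPrime.ext fun n => h (n.toNat + 1) n (by omega)

theorem eq_zero_of_forall_mem_spNhd {X : sp} (h : ∀ n, X ∈ spNhd n) : X = 0 := by
  refine Subtype.ext (LinearMap.ext fun f => eq_zero_of_forall_mem_lattice fun n => ?_)
  obtain ⟨m, hm⟩ := exists_mem_lattice f
  exact lattice_anti (by omega) (h (n + (-m).toNat) f (lattice_anti (by omega) hm))

instance : T2Space sp :=
  t2Space_of_basis (B := spNhdSubmodule) nhds_zero_sp fun _ h => eq_zero_of_forall_mem_spNhd h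

instance : ContinuousConstSMul ℂ sp :=
  continuousConstSMul_of_basis (B := spNhdSubmodule) nhds_zero_sp

instance : T2Space SpH :=
  t2Space_of_basis nhds_zero_SpH fun _ h => LieAlgebra.SemiDirectSum.ext
    (eq_zero_of_forall_mem_lattice fun n => (h n).2)
    (eq_zero_of_forall_mem_spNhd fun n => (h n).1)

instance : ContinuousConstSMul ℂ SpH := continuousConstSMul_of_basis nhds_zero_SpH

theorem tendsto_sp_nhds_zero {T : Type*} {u : Filter T} {f : T → sp}
    (h : ∀ n : ℕ, ∀ᶠ t in u, f t ∈ spNhd n) : Tendsto f u (𝓝 0) :=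
  nhds_zero_sp.tendsto_right_iff.2 fun n _ => h n

theorem spNhd_mem_nhds (n : ℕ) : ∀ᶠ X : sp in 𝓝 0, X ∈ spNhd n :=
  nhds_zero_sp.mem_of_mem trivial

theorem eventually_lattice {m n : ℤ} : ∀ᶠ X : sp in 𝓝 0,
    ∀ f ∈ lattice m, (X : Module.End ℂ HPrime) f ∈ lattice n := by
  filter_upwards [spNhd_mem_nhds (max (-m).toNat n.toNat)] with X hX f hf
  exact lattice_anti (by omega) (hX f (lattice_anti (by omega) hf))

theorem continuous_sp_apply :
    Continuous fun p : sp × HPrime => (p.1 : Module.End ℂ HPrime) p.2 := by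
  refine continuous_of_biadditive (f := fun (X : sp) f => (X : Module.End ℂ HPrime) f)
    (fun X Y f => rfl) (fun X f g => map_add _ f g) ?_ (fun X => ?_) (fun f => ?_)
  · refine nhds_zero_basis.tendsto_right_iff.2 fun n _ => ?_
    filter_upwards [(eventually_lattice (m := 0) (n := n)).prod_mk
      (nhds_zero_basis.mem_of_mem (i := 0) trivial)] with p hp
    exact hp.1 _ hp.2
  · simpa using X.2.1.tendsto 0
  · obtain ⟨m, hm⟩ := exists_mem_lattice f
    refine nhds_zero_basis.tendsto_right_iff.2 fun n _ => ?_
    filter_upwards [eventually_lattice (m := m) (n := n)] with X hX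
    exact hX f hm

/-- In `XY`, a small `Y` lands in a lattice that `X` sends deep enough; in `YX`, the lattice is
first moved by `X` to another lattice, on which `Y` is small. -/
theorem eventually_lie_mem (X : sp) (n : ℕ) : ∀ᶠ Y : sp in 𝓝 0, ⁅X, Y⁆ ∈ spNhd n := by
  obtain ⟨m, hm⟩ := sp_isCts X n
  obtain ⟨k, hk⟩ := (sp_isCts X).exists_lattice (-(n : ℤ))
  filter_upwards [eventually_lattice (m := -(n : ℤ)) (n := m),
    eventually_lattice (m := k) (n := (n : ℤ))] with Y h1 h2 f hf
  exact Submodule.sub_mem _ (hm _ (h1 f hf)) (h2 _ (hk f hf))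

theorem continuous_sp_lie : Continuous fun p : sp × sp => ⁅p.1, p.2⁆ := by
  refine continuous_of_biadditive (f := fun X Y : sp => ⁅X, Y⁆) add_lie lie_add ?_
    (fun X => tendsto_sp_nhds_zero (eventually_lie_mem X)) (fun Y => ?_)
  · refine tendsto_sp_nhds_zero fun n => ?_
    filter_upwards [(spNhd_mem_nhds n).prod_mk (spNhd_mem_nhds n)] with p hp f hf
    exact Submodule.sub_mem _ (hp.1 _ (lattice_anti (by omega) (hp.2 f hf)))
      (hp.2 _ (lattice_anti (by omega) (hp.1 f hf)))
  · refine tendsto_sp_nhds_zero fun n => ?_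
    filter_upwards [eventually_lie_mem Y n] with X hX
    rw [← lie_skew]
    exact (spNhdSubmodule n).neg_mem hX

theorem continuous_SpH_lie : Continuous fun p : SpH × SpH => ⁅p.1, p.2⁆ := by
  simp only [SpH.lie_def]
  have r1 : Continuous fun p : SpH × SpH => p.1.right := continuous_right.comp continuous_fst
  have r2 : Continuous fun p : SpH × SpH => p.2.right := continuous_right.comp continuous_snd
  have l1 : Continuous fun p : SpH × SpH => p.1.left := continuous_left.comp continuous_fst
  have l2 : Continuous fun p : SpH × SpH => p.2.left := continuous_left.comp continuous_snd
  exact continuous_mk_SpH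
    ((continuous_sp_apply.comp (r1.prodMk l2)).sub (continuous_sp_apply.comp (r2.prodMk l1)))
    (continuous_sp_lie.comp (r1.prodMk r2))

/-! ### Local constancy of `ψ` and of the symplectic form -/

theorem piMinus_apply_of_mem {f : HPrime} (hf : f ∈ lattice 0) : piMinus f = 0 :=
  HPrime.ext fun n => by
    rw [coeff_piMinus]
    split_ifs with h
    · exact hf n h
    · rfl

theorem piPlus_apply_mem (f : HPrime) : piPlus f ∈ lattice 0 := fun n hn => by
  rw [coeff_piPlus, if_pos hn]

theorem piMinus_mul_piPlus_eq_zero {X : sp} (hX : X ∈ spNhd 0) (f : HPrime) :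
    piMinus ((X : Module.End ℂ HPrime) (piPlus f)) = 0 :=
  piMinus_apply_of_mem (hX _ (piPlus_apply_mem f))

/-- Elements of `spNhd 0` preserve `ℂ⟦t⟧ ∩ H' = H'_+`, so `π_- X π_+` and `π_- Y π_+` vanish. -/
theorem psi_eq_zero {X Y : sp} (hX : X ∈ spNhd 0) (hY : Y ∈ spNhd 0) : psi X Y = 0 := by
  unfold psi
  rw [← trace_zero]
  congr 1
  refine LinearMap.ext fun f => ?_
  simp only [LinearMap.sub_apply, Module.End.mul_apply, piMinus_mul_piPlus_eq_zero hX,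
    piMinus_mul_piPlus_eq_zero hY, map_zero, sub_zero, LinearMap.zero_apply]

/-- For fixed `Y`, `π_- Y π_+` kills `t ^ N ℂ⟦t⟧ ∩ H'` and takes values in `t ^ (-N) ℂ⟦t⟧`. If `X`
preserves `H'_+` and maps the latter lattice into `t ^ N ℂ⟦t⟧`, every diagonal entry is zero: those
with `n ≥ N` by the first property, those with `n < N` by the second. -/
theorem eventually_psi_eq_zero (Y : sp) : ∀ᶠ X : sp in 𝓝 0, psi X Y = 0 := by
  obtain ⟨N, h1, h2⟩ := isNuc_minus_plus (sp_isCts Y)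
  filter_upwards [spNhd_mem_nhds 0, eventually_lattice (m := -N) (n := N)] with X h0 hX
  unfold psi trace
  refine finsum_eq_zero_of_forall_eq_zero fun n => ?_
  simp only [LinearMap.sub_apply, Module.End.mul_apply, piMinus_mul_piPlus_eq_zero h0, map_zero,
    sub_zero]
  rw [coeff_piPlus]
  split_ifs
  · rfl
  by_cases hn : N ≤ n
  · have h := h1 _ (lattice_anti hn (b_mem n))
    rw [Module.End.mul_apply, Module.End.mul_apply] at h
    rw [h, map_zero]
    rfl
  · exact hX _ (h2 (b n)) n (not_le.1 hn)

theorem continuous_psi : @Continuous (sp × sp) ℂ _ ⊥ fun p => psiSp p.1 p.2 := by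
  let : TopologicalSpace ℂ := ⊥
  have : DiscreteTopology ℂ := ⟨rfl⟩
  refine continuous_of_biadditive (f := fun X Y : sp => psiSp X Y)
    (fun X X' Y => by rw [map_add, LinearMap.add_apply]) (fun X Y Y' => map_add _ _ _) ?_
    (fun X => ?_) (fun Y => ?_) <;> rw [nhds_discrete ℂ, tendsto_pure]
  · filter_upwards [(spNhd_mem_nhds 0).prod_mk (spNhd_mem_nhds 0)] with p hp
    exact psi_eq_zero hp.1 hp.2
  · filter_upwards [eventually_psi_eq_zero X] with Y hY
    exact (psi_skew (sp_isCts Y) (sp_isCts X)).trans (neg_eq_zero.2 hY)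
  · exact eventually_psi_eq_zero Y

theorem continuous_symp : @Continuous (HPrime × HPrime) ℂ _ ⊥ fun p => symp p.1 p.2 := by
  let : TopologicalSpace ℂ := ⊥
  have : DiscreteTopology ℂ := ⟨rfl⟩
  have h1 : ∀ f : HPrime, ∀ᶠ g in 𝓝 (0 : HPrime), symp f g = 0 := fun f => by
    obtain ⟨N, hN⟩ := exists_symp_eq_zero f
    exact nhds_zero_basis.eventually_iff.2 ⟨N, trivial, hN⟩
  have hP : ∀ᶠ f in 𝓝 (0 : HPrime), f ∈ HPlus := nhds_zero_basis.mem_of_mem trivial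
  refine continuous_of_biadditive (f := fun f g : HPrime => symp f g)
    (fun f f' g => by rw [map_add, LinearMap.add_apply]) (fun f g g' => map_add _ _ _) ?_
    (fun f => ?_) (fun g => ?_) <;> rw [nhds_discrete ℂ, tendsto_pure]
  · filter_upwards [hP.prod_mk hP] with p hp
    exact symp_eq_zero_of_mem_HPlus hp.1 hp.2
  · exact h1 f
  · filter_upwards [h1 g] with f hf
    rw [symp_skew, hf, neg_zero]

theorem isContinuousCentral_mp : IsContinuousCentral mp := by
  refine isContinuousCentral_ofTwoCocycle continuous_sp_lie mpCocycle ?_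
  let : TopologicalSpace ℂ := ⊥
  have : DiscreteTopology ℂ := ⟨rfl⟩
  exact (continuous_of_discreteTopology (f := fun z : ℂ => (-1 / 2 : ℂ) * z)).comp continuous_psi

theorem isContinuousCentral_weylTwo : IsContinuousCentral weylTwo := by
  refine isContinuousCentral_ofTwoCocycle continuous_SpH_lie weylCocycle ?_
  let : TopologicalSpace ℂ := ⊥
  have : DiscreteTopology ℂ := ⟨rfl⟩
  have r1 : Continuous fun p : SpH × SpH => p.1.right := continuous_right.comp continuous_fst
  have r2 : Continuous fun p : SpH × SpH => p.2.right := continuous_right.comp continuous_snd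
  have l1 : Continuous fun p : SpH × SpH => p.1.left := continuous_left.comp continuous_fst
  have l2 : Continuous fun p : SpH × SpH => p.2.left := continuous_left.comp continuous_snd
  exact (continuous_of_discreteTopology (f := fun z : ℂ × ℂ => (-1 / 2 : ℂ) * z.1 + z.2)).comp
    ((continuous_psi.comp (r1.prodMk r2)).prodMk (continuous_symp.comp (l1.prodMk l2)))

end
end Metaplectic

open Metaplectic in
theorem mainTheorem9 (Z F : Submodule ℂ HPrime) (hZ : IsLagrangian Z) (hZP : Z ⊓ HPlus = ⊥)
    (hF : F ≤ Z) :
    ((∀ (E : LieAlgebra.Extension ℂ ℂ sp) [TopologicalSpace E.L], IsContinuousCentral E →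
        SplitsOver E (spF F (hZ.le_perp hF))) ∧
      IsContinuousCentral mp ∧ SplitsOver mp (spF F (hZ.le_perp hF))) ∧
    ((∀ (E : LieAlgebra.Extension ℂ ℂ SpH) [TopologicalSpace E.L], IsContinuousCentral E →
        SplitsOver E (spFH F (hZ.le_perp hF))) ∧
      IsContinuousCentral weylTwo ∧ SplitsOver weylTwo (spFH F (hZ.le_perp hF))) :=
  ⟨⟨fun E _ hE => splitsOver_spF hZ hZP hF E hE, isContinuousCentral_mp,
      splitsOver_spF hZ hZP hF mp isContinuousCentral_mp⟩,
    ⟨fun E _ hE => splitsOver_spFH hZ hZP hF E hE, isContinuousCentral_weylTwo,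
      splitsOver_spFH hZ hZP hF weylTwo isContinuousCentral_weylTwo⟩⟩
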